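/- **Setting.** Let $n,M\ge 1$, let $\mathcal Z$ be a set, $Z_1,\dots,Z_n\in\mathcal Z$ deterministic points, $f:\mathcal Z\to\mathbb R$, and let $Y_i=f(Z_i)+\xi_i$, $i=1,\dots,n$, where $\xi_1,\dots,\xi_n$ are i.i.d. real random variables with mean zero. Write $\|h\|_n^2=\frac1n\sum_{i=1}^n h(Z_i)^2$ for $h:\mathcal Z\to\mathbb R$, and $\|\lambda\|_1=\sum_j|\lambda_j|$ for $\lambda\in\mathbb R^M$. *Assumption on the noise.* There are $t_0\in(0,\infty]$ and a bounded Borel function $v:\mathbb R\to[0,\infty)$ such that for all small enough $\gamma>0$ there are a probability space and random variables $\xi,\zeta$ on it (depending on $\gamma$) such that $\xi$ has the law of $\xi_1$; $\xi+\zeta$ has the law of $(1+\gamma)\xi$ and $\mathbf E[\zeta\mid\xi]=0$; and $$\limsup_{\gamma\to0}\ \sup_{|t|\le t_0,\ a\in\operatorname{supp}(\xi)}\frac{\log\mathbf E[e^{t\zeta}\mid\xi=a]}{t^2\gamma\,v(a)}\le1,$$ meaning that for every $\varepsilon>0$ and all small enough $\gamma>0$, $\log\mathbf E[e^{t\zeta}\mid\xi=a]\le(1+\varepsilon)t^2\gamma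 v(a)$ for all $|t|\le t_0$ (all real $t$ if $t_0=\infty$) and almost all $a$ with respect to the law of $\xi_1$. Put $\|v\|_\infty=\sup_{a\in\mathbb R}v(a)$. *Family.* Let $g:\mathbb R\to\mathbb R$ be twice continuously differentiable, let $\phi_1,\dots,\phi_M:\mathcal Z\to\mathbb R$ satisfy $\frac1n\sum_{i=1}^n\phi_j(Z_i)^2=1$ for every $j$, let $R\in(0,\infty]$, $\Lambda=\{\lambda\in\mathbb R^M:\|\lambda\|_1\le R\}$ and $f_\lambda(z)=g\big(\sum_{j=1}^M\lambda_j\phi_j(z)\big)$. Let $L=\sup_{\lambda,\lambda'\in\Lambda}\max_i|f_\lambda(Z_i)-f_{\lambda'}(Z_i)|\in[0,\infty]$. *Prior and aggregate.* Let $\alpha,\tau>0$ and let $\bar\omega(t)=t^2$ for $|t|\le1$, $\bar\omega(t)=2|t|-1$ for $|t|>1$. Let $\pi$ be the probability measure on $\mathbb R^M$ with Lebesgue density proportional to $$\mathbf 1(\|\lambda\|_1\le R)\prod_{j=1}^M\frac{e^{-\bar\omega(\alpha\lambda_j)}}{(\tau^2+\lambda_j^2)^2}.$$ For $\beta>0$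 let $\widehat\pi(d\lambda)\propto\exp\{-\beta^{-1}\sum_{i=1}^n(Y_i-f_\lambda(Z_i))^2\}\,\pi(d\lambda)$ and $\widehat f_n(z)=\int f_\lambda(z)\,\widehat\pi(d\lambda)$. **Theorem.** Assume that the assumption on the noise holds with $t_0$ and $v$, that $\beta\ge\max(4\|v\|_\infty,2L/t_0)$ (with the convention $\infty/\infty=0$), $R>2M\tau$ and $\alpha\le1/(4M\tau)$. Then $\widehat f_n$ is well defined at the design points, and for every $\lambda^*\in\mathbb R^M$ with $\|\lambda^*\|_1\le R-2M\tau$, $$\mathbf E\big[\|\widehat f_n-f\|_n^2\big]\le\|f_{\lambda^*}-f\|_n^2+\frac{4\beta}n\sum_{j=1}^M\log\Big(1+\frac{|\lambda_j^*|}\tau\Big)+\frac{2\beta(\alpha\|\lambda^*\|_1+1)}n+4e\,C_{g,f}\,\tau^2M,$$ where $C_{g,f}=1$ if $g(x)=x$ and $C_{g,f}=\|g'\|_\infty^2+\|g''\|_\infty(\|g\|_\infty+\|f\|_\infty)\in[0,\infty]$ (with $0\cdot\infty=0$) for other $g$; here $\|f\|_\infty=\max_i|f(Z_i)|$, and the norms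 of $g,g',g''$ are suprema of absolute values over the interval $[-RL_\phi,RL_\phi]$, $L_\phi=\max_{i,j}|\phi_j(Z_i)|$ (over $\mathbb R$ if $R=\infty$). -/

import Mathlib

open MeasureTheory ProbabilityTheory Filter Topology
open scoped ENNReal NNReal

noncomputable section

namespace SparseEWA

/-! ### Assumption on the noise -/

/-- Assumption N on the noise distribution `ν`, with constant `t₀ ∈ (0, ∞]` and bounded Borel
function `v : ℝ → [0, ∞)`. For all small `γ > 0` there are a probability space and random
variables `ξ, ζ` on it such that `ξ ∼ ν`, `ξ + ζ ∼ (1 + γ) ξ`, `E[ζ | ξ] = 0`, and the limsup, as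
`γ → 0+`, of the supremum over `|t| ≤ t₀` and over `a` of
`log E[exp (t ζ) | ξ = a] / (t² γ v a)` is at most one.

The last condition is written with the denominator cleared, which gives the ratio `0 / 0` its
intended meaning (for instance at `t = 0`). The conditional expectation given `ξ = a` is only
defined for `ν`-almost every `a`, and is taken with respect to the regular conditional
distribution of `ζ` given `ξ`. -/
structure AssumptionN (ν : Measure ℝ) (t₀ : ℝ≥0∞) (v : ℝ → ℝ≥0) : Prop where
  t₀_pos : 0 < t₀
  measurable_v : Measurable v
  bounded_v : BddAbove (Set.range v)
  exists_pair : ∃ (γ₀ : ℝ) (Ω : ℝ → Type) (_ : ∀ γ, MeasurableSpace (Ω γ))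
      (P : ∀ γ, Measure (Ω γ)) (_ : ∀ γ, IsProbabilityMeasure (P γ)) (ξ ζ : ∀ γ, Ω γ → ℝ),
    0 < γ₀ ∧
    (∀ γ : ℝ, 0 < γ → γ < γ₀ →
      Measurable (ξ γ) ∧ Measurable (ζ γ) ∧
      (P γ).map (ξ γ) = ν ∧
      (P γ).map (fun ω => ξ γ ω + ζ γ ω) = (P γ).map (fun ω => (1 + γ) * ξ γ ω) ∧
      Integrable (ζ γ) (P γ) ∧
      (P γ)[ζ γ | MeasurableSpace.comap (ξ γ) inferInstance] =ᵐ[P γ] 0) ∧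
    ∀ ε : ℝ, 0 < ε → ∀ᶠ γ : ℝ in 𝓝[>] 0, ∀ᵐ a ∂ν, ∀ t : ℝ, ENNReal.ofReal |t| ≤ t₀ →
      ∫⁻ z, ENNReal.ofReal (Real.exp (t * z)) ∂(condDistrib (ζ γ) (ξ γ) (P γ) a) ≤
        ENNReal.ofReal (Real.exp ((1 + ε) * (t ^ 2 * γ * v a)))

/-! ### Norms -/

/-- The square of the empirical norm, `‖h‖ₙ² = (1/n) ∑ᵢ h(Zᵢ)²`. -/
def empNormSq {𝒵 : Type*} {n : ℕ} (Z : Fin n → 𝒵) (h : 𝒵 → ℝ) : ℝ :=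
  (1 / (n : ℝ)) * ∑ i, h (Z i) ^ 2

/-- The `ℓ¹` norm on `ℝ^M`. -/
def l1Norm {M : ℕ} (lam : Fin M → ℝ) : ℝ := ∑ j, |lam j|

/-- The closed `ℓ¹` ball of radius `R ∈ [0, ∞]` in `ℝ^M`. -/
def l1Ball (M : ℕ) (R : ℝ≥0∞) : Set (Fin M → ℝ) := {lam | ENNReal.ofReal (l1Norm lam) ≤ R}

/-- The supremum of `|h|` over the set `s`, as an element of `[0, ∞]`. -/
def supOn (s : Set ℝ) (h : ℝ → ℝ) : ℝ≥0∞ := ⨆ x ∈ s, ENNReal.ofReal |h x|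

/-- The supremum norm of a nonnegative function on `ℝ`, as an element of `[0, ∞]`. -/
def supNorm (v : ℝ → ℝ≥0) : ℝ≥0∞ := ⨆ a, (v a : ℝ≥0∞)

/-! ### The exponentially weighted aggregate -/

/-- The posterior `π̂(dλ) ∝ exp(-‖Y - f_λ‖₂² / β) π(dλ)`. -/
def posterior {𝒵 Λ : Type*} [MeasurableSpace Λ] {n : ℕ} (Z : Fin n → 𝒵) (F : Λ → 𝒵 → ℝ)
    (π : Measure Λ) (β : ℝ) (Y : Fin n → ℝ) : Measure Λ :=
  π.tilted (fun lam => -(β⁻¹ * ∑ i, (Y i - F lam (Z i)) ^ 2))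

/-- The exponentially weighted aggregate `f̂ₙ(z) = ∫ f_λ(z) π̂(dλ)`. -/
def ewa {𝒵 Λ : Type*} [MeasurableSpace Λ] {n : ℕ} (Z : Fin n → 𝒵) (F : Λ → 𝒵 → ℝ)
    (π : Measure Λ) (β : ℝ) (Y : Fin n → ℝ) (z : 𝒵) : ℝ :=
  ∫ lam, F lam z ∂(posterior Z F π β Y)

/-- The smallest `L ∈ [0, ∞]` such that `maxᵢ |f_λ(Zᵢ) - f_λ'(Zᵢ)| ≤ L` for all `λ, λ' ∈ S`. -/
def spread {𝒵 Λ : Type*} {n : ℕ} (Z : Fin n → 𝒵) (F : Λ → 𝒵 → ℝ) (S : Set Λ) : ℝ≥0∞ :=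
  ⨆ lam ∈ S, ⨆ lam' ∈ S, ⨆ i, ENNReal.ofReal |F lam (Z i) - F lam' (Z i)|

/-! ### The family with a link function -/

/-- `f_λ(z) = g(∑ⱼ λⱼ φⱼ(z))`. -/
def linkFamily {𝒵 : Type*} {M : ℕ} (g : ℝ → ℝ) (φ : Fin M → 𝒵 → ℝ) (lam : Fin M → ℝ) (z : 𝒵) : ℝ :=
  g (∑ j, lam j * φ j z)

/-- `L_φ = max_{i,j} |φⱼ(Zᵢ)|`. -/
def dictSup {𝒵 : Type*} {n M : ℕ} (Z : Fin n → 𝒵) (φ : Fin M → 𝒵 → ℝ) : ℝ≥0∞ :=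
  ⨆ i, ⨆ j, ENNReal.ofReal |φ j (Z i)|

/-- The interval `[-R L_φ, R L_φ]` (all of `ℝ` if `R = ∞` and `L_φ > 0`). -/
def linkInterval {𝒵 : Type*} {n M : ℕ} (Z : Fin n → 𝒵) (φ : Fin M → 𝒵 → ℝ) (R : ℝ≥0∞) : Set ℝ :=
  {x | ENNReal.ofReal |x| ≤ R * dictSup Z φ}

open Classical in
/-- `C_{g,f} = 1` if `g(x) = x`, and `‖g'‖∞² + ‖g''‖∞ (‖g‖∞ + ‖f‖∞)` otherwise, where the norms of
`g, g', g''` are suprema over `[-R L_φ, R L_φ]` and `‖f‖∞ = maxᵢ |f(Zᵢ)|`. -/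
def linkConst {𝒵 : Type*} {n M : ℕ} (Z : Fin n → 𝒵) (φ : Fin M → 𝒵 → ℝ) (R : ℝ≥0∞)
    (g : ℝ → ℝ) (f : 𝒵 → ℝ) : ℝ≥0∞ :=
  if g = id then 1
  else supOn (linkInterval Z φ R) (deriv g) ^ 2 +
    supOn (linkInterval Z φ R) (deriv (deriv g)) *
      (supOn (linkInterval Z φ R) g + ⨆ i, ENNReal.ofReal |f (Z i)|)

/-! ### The sparsity prior -/

/-- The Huber function. -/
def huber (t : ℝ) : ℝ := if |t| ≤ 1 then t ^ 2 else 2 * |t| - 1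

/-- The unnormalised density of the sparsity prior. -/
def sparsityWeight (M : ℕ) (α τ : ℝ) (R : ℝ≥0∞) : (Fin M → ℝ) → ℝ :=
  (l1Ball M R).indicator fun lam =>
    τ ^ (2 * M) * ∏ j, Real.exp (-huber (α * lam j)) / (τ ^ 2 + lam j ^ 2) ^ 2

/-- The sparsity prior: the probability measure on `ℝ^M` whose Lebesgue density is proportional to
`∏ⱼ exp(-ω(α λⱼ)) / (τ² + λⱼ²)²` on the `ℓ¹` ball of radius `R`, and zero outside of it. -/
def sparsityPrior (M : ℕ) (α τ : ℝ) (R : ℝ≥0∞) : Measure (Fin M → ℝ) :=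
  (∫⁻ lam, ENNReal.ofReal (sparsityWeight M α τ R lam))⁻¹ •
    (volume : Measure (Fin M → ℝ)).withDensity
      (fun lam => ENNReal.ofReal (sparsityWeight M α τ R lam))

end SparseEWA

end

/-! Write `h λ i = F λ (Z i) - f (Z i)` and let `x` be the noise vector. Expanding the square, the
posterior is the Gibbs measure with weight `exp(-(‖h‖² - 2⟨x, h⟩)/β)` relative to the prior, and the
error of the aggregate at the design points is the Gibbs mean `m(x)` of `h`. Let `A(s, x)` be the
log-partition function with `‖h‖²` replaced by `s‖h‖²`.

The heart is `E‖m(ξ)‖² ≤ -β E A(1, ξ)`, obtained by comparing the noise with its dilation. For a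
coupling `ξ + ζ ∼ (1+γ)ξ`, the mean of `A(1+γ, ξ+ζ)` is that of `A(1+γ, (1+γ)ξ)`, whose integrand is
a `(1+γ)`-th power, so Jensen bounds it below by `(1+γ) E A(1, ξ)` (`mul_log_integral_exp_le`). From
above, expand `A(1+γ, ξ+ζ)` around `A(1, ξ)` (`logPartition_add_le`): the first-order term
`(2/β)⟨m(ξ), ζ⟩` has mean zero, and the remainder is an exponential moment of `(2/β)⟨h - m, ζ⟩`. As
`v ≤ β/4` and `2L/β ≤ t₀`, the noise assumption bounds that moment by essentially `exp((γ/β)(-‖h‖² +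
‖h-m‖²))`. The exponent is linear in `h`, with Gibbs mean `-(γ/β)‖m‖²`. Dividing by `γ` and sending
the errors to zero gives the claim (`AssumptionN.integral_gibbsMean_sq_le`).

By Jensen, if a probability measure satisfies `p ≤ e^B π`, then `-β A(1, x)` is at most `∫ (‖h‖² -
2⟨x, h⟩) dp + βB`; the cross term is centred, so `E‖m‖² ≤ ∫ ‖h‖² dp + βB`.

For `p` take the law of `λ* + u`, where `u` has independent coordinates with density proportional to
`(τ² + u²)⁻²`, conditioned on `‖u‖₁ ≤ 2Mτ`. The conditioning event has probability at least `1/2`,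
symmetry makes the coordinates centred and uncorrelated, and their variances are at most `2τ²`. The
heavy tails make a translation by `λ*` cost only logarithms (`map_localMeasure_le`), and a
second-order expansion of the loss in the linear predictor gives the approximation term
(`integral_sq_link_le`).

This needs a bounded family, which holds for finite `R`. For `R = ∞` the prior is truncated to large
balls, with bounds uniform in the radius, and Fatou's lemma concludes. -/

noncomputable section

namespace SparseEWA

/-! ### Couplings of the noise with its dilation -/

/-- The law `μ` of a pair `(ξ, ζ)` with `ξ ∼ ν`, `ξ + ζ ∼ (1 + γ) ξ`, `E[ζ | ξ] = 0`, and
`E[exp (t ζ) | ξ] ≤ exp (c t²)` for `|t| ≤ T`. -/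
structure IsNoiseCoupling (ν : Measure ℝ) (μ : Measure (ℝ × ℝ)) (γ T c : ℝ) : Prop where
  isProbabilityMeasure : IsProbabilityMeasure μ
  map_fst : μ.map Prod.fst = ν
  map_add : μ.map (fun p => p.1 + p.2) = ν.map (fun x => (1 + γ) * x)
  integrable_snd : Integrable (fun p : ℝ × ℝ => p.2) μ
  integral_mul_eq_zero : ∀ b : ℝ → ℝ, Measurable b → ∀ C, (∀ x, |b x| ≤ C) →
    ∫ p, b p.1 * p.2 ∂μ = 0
  lintegral_exp_le : ∀ (A : ℝ → ℝ≥0∞) (t : ℝ → ℝ), Measurable A → Measurable t →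
    (∀ x, |t x| ≤ T) →
    ∫⁻ p, A p.1 * ENNReal.ofReal (Real.exp (t p.1 * p.2)) ∂μ ≤
      ∫⁻ p, A p.1 * ENNReal.ofReal (Real.exp (c * t p.1 ^ 2)) ∂μ

lemma integral_mul_eq_zero_of_condExp_eq_zero {Ω : Type*} {m : MeasurableSpace Ω}
    {P : Measure Ω} [IsProbabilityMeasure P] {X W : Ω → ℝ} (hX : Measurable X)
    (hW : Integrable W P)
    (h0 : P[W | MeasurableSpace.comap X inferInstance] =ᵐ[P] 0)
    {b : ℝ → ℝ} (hb : Measurable b) {C : ℝ} (hC : ∀ x, |b x| ≤ C) :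
    ∫ ω, b (X ω) * W ω ∂P = 0 := by
  have hm : MeasurableSpace.comap X inferInstance ≤ m := hX.comap_le
  have hbX : StronglyMeasurable[MeasurableSpace.comap X inferInstance] (fun ω => b (X ω)) :=
    (hb.comp (comap_measurable X)).stronglyMeasurable
  have hint : Integrable ((fun ω => b (X ω)) * W) P := by
    refine hW.bdd_mul (c := C) ((hb.comp hX).aestronglyMeasurable) ?_
    exact ae_of_all _ fun ω => hC _
  have h1 := condExp_mul_of_stronglyMeasurable_left hbX hint hW
  calc ∫ ω, b (X ω) * W ω ∂P
      = ∫ ω, (P[(fun ω => b (X ω)) * W | MeasurableSpace.comap X inferInstance]) ω ∂P :=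
        (integral_condExp hm).symm
    _ = ∫ _, (0 : ℝ) ∂P := by
        refine integral_congr_ae ?_
        filter_upwards [h1, h0] with ω h1 h0
        rw [h1, Pi.mul_apply, h0]; simp
    _ = 0 := by simp

/-- Passing to the joint law of `(ξ, ζ)` removes the auxiliary probability space. The joint law
disintegrates over `ν`, and the conditional moment bound holds for almost every `a` simultaneously
in `t`; this is what lets `t` depend on `ξ`, as it must when it is built from the Gibbs mean. -/
lemma AssumptionN.exists_isNoiseCoupling {ν : Measure ℝ} {t₀ : ℝ≥0∞} {v : ℝ → ℝ≥0}
    (hN : AssumptionN ν t₀ v) {T V ε : ℝ} (hT : ENNReal.ofReal T ≤ t₀) (hV : ∀ a, (v a : ℝ) ≤ V)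
    (hε : 0 < ε) :
    ∀ᶠ γ : ℝ in 𝓝[>] 0, ∃ μ : Measure (ℝ × ℝ),
      IsNoiseCoupling ν μ γ T ((1 + ε) * γ * V) := by
  obtain ⟨γ₀, Ω, mΩ, P, hP, X, W, hγ₀, h1, h2⟩ := hN.exists_pair
  filter_upwards [h2 ε hε, Ioo_mem_nhdsGT hγ₀] with γ hγ hγI
  obtain ⟨hX, hW, hlaw, hadd, hint, hcond⟩ := h1 γ hγI.1 hγI.2
  have hXW : Measurable fun ω => (X γ ω, W γ ω) := hX.prodMk hW
  have hcomp : ν ⊗ₘ condDistrib (W γ) (X γ) (P γ) = (P γ).map fun ω => (X γ ω, W γ ω) := by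
    rw [← hlaw]; exact compProd_map_condDistrib hW.aemeasurable
  have hνp : IsProbabilityMeasure ν := by
    rw [← hlaw]; exact Measure.isProbabilityMeasure_map hX.aemeasurable
  refine ⟨(P γ).map fun ω => (X γ ω, W γ ω), ?_, ?_, ?_, ?_, ?_, ?_⟩
  · exact Measure.isProbabilityMeasure_map hXW.aemeasurable
  · rw [Measure.map_map measurable_fst hXW]; exact hlaw
  · rw [Measure.map_map (by fun_prop) hXW, ← hlaw, Measure.map_map (by fun_prop) hX]
    exact hadd
  · rw [integrable_map_measure measurable_snd.aestronglyMeasurable hXW.aemeasurable]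
    exact hint
  · intro b hb C hC
    rw [integral_map hXW.aemeasurable (by fun_prop)]
    exact integral_mul_eq_zero_of_condExp_eq_zero hX hint hcond hb hC
  · intro A t hA ht htT
    have hAm : Measurable fun p : ℝ × ℝ => A p.1 * ENNReal.ofReal (Real.exp (t p.1 * p.2)) := by
      fun_prop
    have hAm' : Measurable fun p : ℝ × ℝ =>
        A p.1 * ENNReal.ofReal (Real.exp ((1 + ε) * γ * V * t p.1 ^ 2)) := by
      fun_prop
    rw [← hcomp, Measure.lintegral_compProd hAm, Measure.lintegral_compProd hAm']
    refine lintegral_mono_ae ?_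
    filter_upwards [hγ] with a ha
    rw [lintegral_const_mul _ (by fun_prop)]
    simp only [lintegral_const, measure_univ, mul_one]
    gcongr
    refine (ha (t a) ((ENNReal.ofReal_le_ofReal (htT a)).trans hT)).trans ?_
    refine ENNReal.ofReal_le_ofReal (Real.exp_le_exp.2 ?_)
    have h3 := hV a
    have h4 : 0 ≤ (1 + ε) * (t a ^ 2 * γ) := by have := hγI.1; positivity
    nlinarith [mul_le_mul_of_nonneg_left h3 h4]

/-! ### Products of couplings -/

lemma lintegral_pi_le_of_update_le {ι : Type*} [Fintype ι] [DecidableEq ι] {X : ι → Type*}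
    [∀ i, MeasurableSpace (X i)] (μ : ∀ i, Measure (X i)) [∀ i, SigmaFinite (μ i)]
    {f g : (∀ i, X i) → ℝ≥0∞} (hf : Measurable f) (hg : Measurable g) (i : ι)
    (h : ∀ x, ∫⁻ y, f (Function.update x i y) ∂μ i ≤ ∫⁻ y, g (Function.update x i y) ∂μ i) :
    ∫⁻ x, f x ∂Measure.pi μ ≤ ∫⁻ x, g x ∂Measure.pi μ := by
  rcases isEmpty_or_nonempty (∀ i, X i) with hX | ⟨⟨x⟩⟩
  · simp [Measure.eq_zero_of_isEmpty]
  · rw [lintegral_eq_lmarginal_univ x, lintegral_eq_lmarginal_univ x,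
      lmarginal_erase' _ hf (Finset.mem_univ i), lmarginal_erase' _ hg (Finset.mem_univ i)]
    exact lmarginal_mono h x

lemma integral_pi_eq_zero_of_insertNth {n : ℕ} {X : Type*} [MeasurableSpace X] (μ : Measure X)
    [SigmaFinite μ] {f : (Fin (n + 1) → X) → ℝ} (hf : Integrable f (Measure.pi fun _ => μ))
    (i : Fin (n + 1)) (h : ∀ x : Fin n → X, ∫ y, f (i.insertNth y x) ∂μ = 0) :
    ∫ x, f x ∂Measure.pi (fun _ => μ) = 0 := by
  have hmp := measurePreserving_piFinSuccAbove (fun _ : Fin (n + 1) => μ) i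
  have hmp' := hmp.symm
  rw [← hmp'.integral_comp']
  have hi : Integrable (fun q => f ((MeasurableEquiv.piFinSuccAbove (fun _ => X) i).symm q))
      (μ.prod (Measure.pi fun _ => μ)) :=
    (hmp'.integrable_comp_emb (MeasurableEquiv.measurableEmbedding _)).2 hf
  rw [integral_prod_symm _ hi]
  refine integral_eq_zero_of_ae (ae_of_all _ fun x => ?_)
  exact h x

namespace IsNoiseCoupling

variable {ν : Measure ℝ} {μ : Measure (ℝ × ℝ)} {γ T c : ℝ} {n : ℕ}

lemma map_fst_pi (h : IsNoiseCoupling ν μ γ T c) :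
    (Measure.pi fun _ : Fin n => μ).map (fun p i => (p i).1) = Measure.pi fun _ => ν := by
  have := h.isProbabilityMeasure
  have := Measure.isProbabilityMeasure_map (μ := μ) (measurable_fst.aemeasurable)
  refine (Measure.pi_map_pi (μ := fun _ : Fin n => μ) (f := fun _ (p : ℝ × ℝ) => p.1)
    (fun _ => measurable_fst.aemeasurable)).trans ?_
  exact congrArg Measure.pi (funext fun _ => h.map_fst)

lemma map_add_pi [IsProbabilityMeasure ν] (h : IsNoiseCoupling ν μ γ T c) :
    (Measure.pi fun _ : Fin n => μ).map (fun p i => (p i).1 + (p i).2) =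
      (Measure.pi fun _ => ν).map (fun x i => (1 + γ) * x i) := by
  have := h.isProbabilityMeasure
  have m1 : Measurable fun p : ℝ × ℝ => p.1 + p.2 := by fun_prop
  have m2 : Measurable fun x : ℝ => (1 + γ) * x := by fun_prop
  have := Measure.isProbabilityMeasure_map (μ := μ) (m1.aemeasurable)
  have := Measure.isProbabilityMeasure_map (μ := ν) (m2.aemeasurable)
  refine (Measure.pi_map_pi (μ := fun _ : Fin n => μ) (f := fun _ (p : ℝ × ℝ) => p.1 + p.2)
    (fun _ => m1.aemeasurable)).trans ?_
  refine Eq.trans ?_ (Measure.pi_map_pi (μ := fun _ : Fin n => ν)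
    (f := fun _ (x : ℝ) => (1 + γ) * x) (fun _ => m2.aemeasurable)).symm
  exact congrArg Measure.pi (funext fun _ => h.map_add)

lemma integrable_snd_pi (h : IsNoiseCoupling ν μ γ T c) (i : Fin n) :
    Integrable (fun p : Fin n → ℝ × ℝ => (p i).2) (Measure.pi fun _ => μ) := by
  have := h.isProbabilityMeasure
  exact (measurePreserving_eval (fun _ : Fin n => μ) i).integrable_comp_of_integrable
    h.integrable_snd

/-- With all coordinates but the `i`-th frozen, `b` is a bounded function of the `i`-th first
component alone, so the one-dimensional centring applies. Boundedness gives integrability, hence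
Fubini. -/
lemma integral_mul_snd_pi_eq_zero (h : IsNoiseCoupling ν μ γ T c) (i : Fin n)
    {b : (Fin n → ℝ) → ℝ} (hb : Measurable b) {C : ℝ} (hC : ∀ x, |b x| ≤ C) :
    Integrable (fun p : Fin n → ℝ × ℝ => b (fun j => (p j).1) * (p i).2)
        (Measure.pi fun _ => μ) ∧
      ∫ p : Fin n → ℝ × ℝ, b (fun j => (p j).1) * (p i).2 ∂(Measure.pi fun _ => μ) = 0 := by
  have := h.isProbabilityMeasure
  have hbm : Measurable fun p : Fin n → ℝ × ℝ => b (fun j => (p j).1) := by fun_prop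
  have hint : Integrable (fun p : Fin n → ℝ × ℝ => b (fun j => (p j).1) * (p i).2)
      (Measure.pi fun _ => μ) :=
    (h.integrable_snd_pi i).bdd_mul (c := C) hbm.aestronglyMeasurable (ae_of_all _ fun _ => hC _)
  refine ⟨hint, ?_⟩
  obtain _ | m := n
  · exact i.elim0
  · refine integral_pi_eq_zero_of_insertNth μ hint i fun x => ?_
    have h1 := h.integral_mul_eq_zero (fun y => b (i.insertNth y fun j => (x j).1))
      (hb.comp (by
        refine measurable_pi_iff.2 fun j => ?_
        refine Fin.succAboveCases i ?_ (fun k => ?_) j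
        · simpa using measurable_id'
        · simp)) C (fun _ => hC _)
    rw [← h1]
    refine integral_congr_ae (ae_of_all _ fun y => ?_)
    have : (fun j => ((i.insertNth y x : Fin (m + 1) → ℝ × ℝ) j).1) =
        i.insertNth y.1 fun j => (x j).1 := by
      funext j
      refine Fin.succAboveCases i ?_ (fun k => ?_) j <;> simp
    simp [this]

/-- The second components are independent given the first ones, so the exponential factors are
replaced by their bounds one coordinate at a time. -/
lemma lintegral_exp_pi_le (h : IsNoiseCoupling ν μ γ T c)
    {D : (Fin n → ℝ) → ℝ≥0∞} {t : (Fin n → ℝ) → Fin n → ℝ} (hD : Measurable D)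
    (ht : Measurable t) (htT : ∀ x i, |t x i| ≤ T) :
    ∫⁻ p : Fin n → ℝ × ℝ, D (fun j => (p j).1) *
        ENNReal.ofReal (Real.exp (∑ i, t (fun j => (p j).1) i * (p i).2)) ∂(Measure.pi fun _ => μ) ≤
      ∫⁻ p : Fin n → ℝ × ℝ, D (fun j => (p j).1) *
        ENNReal.ofReal (Real.exp (c * ∑ i, t (fun j => (p j).1) i ^ 2))
          ∂(Measure.pi fun _ => μ) := by
  classical
  have := h.isProbabilityMeasure
  -- Interpolation: coordinates in `s` still carry their random exponent, the others already have
  -- the deterministic bound. The claim compares `s = univ` with `s = ∅`.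
  let e : Finset (Fin n) → (Fin n → ℝ × ℝ) → Fin n → ℝ := fun s p i =>
    if i ∈ s then t (fun j => (p j).1) i * (p i).2 else c * t (fun j => (p j).1) i ^ 2
  have hem : ∀ s i, Measurable fun p => e s p i := by
    intro s i
    by_cases hi : i ∈ s <;> simp only [e, hi, if_true, if_false] <;> fun_prop
  let G : Finset (Fin n) → (Fin n → ℝ × ℝ) → ℝ≥0∞ := fun s p =>
    D (fun j => (p j).1) * ENNReal.ofReal (Real.exp (∑ i, e s p i))
  have hGm : ∀ s, Measurable (G s) := by
    intro s
    have := fun i => hem s i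
    simp only [G]
    fun_prop
  have key : ∀ s : Finset (Fin n), ∫⁻ p, G s p ∂(Measure.pi fun _ => μ) ≤
      ∫⁻ p, G ∅ p ∂(Measure.pi fun _ => μ) := by
    intro s
    induction s using Finset.induction_on with
    | empty => exact le_rfl
    | insert i s hi ih =>
      refine le_trans ?_ ih
      refine lintegral_pi_le_of_update_le _ (hGm _) (hGm _) i fun x => ?_
      let u : ℝ → Fin n → ℝ := fun y j => (Function.update x i (y, 0) j).1
      have hu : Measurable u := by
        refine measurable_pi_iff.2 fun j => ?_
        by_cases hj : j = i
        · subst hj; simpa [u] using measurable_id'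
        · simp [u, Function.update_of_ne hj]
      have hup : ∀ y : ℝ × ℝ, (fun j => (Function.update x i y j).1) = u y.1 := by
        intro y; funext j
        by_cases hj : j = i
        · subst hj; simp [u]
        · simp [u, Function.update_of_ne hj]
      let A : ℝ → ℝ≥0∞ := fun y => D (u y) * ENNReal.ofReal (Real.exp (∑ j ∈ Finset.univ.erase i,
        if j ∈ s then t (u y) j * (x j).2 else c * t (u y) j ^ 2))
      have hA : Measurable A := by
        have : ∀ j, Measurable fun y => if j ∈ s then t (u y) j * (x j).2 else c * t (u y) j ^ 2 := by
          intro j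
          by_cases hj : j ∈ s <;> simp only [hj, if_true, if_false] <;> fun_prop
        simp only [A]
        fun_prop
      have h1 := h.lintegral_exp_le A (fun y => t (u y) i) hA (by fun_prop) (fun y => htT _ _)
      have hsum : ∀ (s' : Finset (Fin n)), (∀ j, j ≠ i → (j ∈ s' ↔ j ∈ s)) → ∀ y : ℝ × ℝ,
          G s' (Function.update x i y) =
            A y.1 * ENNReal.ofReal (Real.exp (e s' (Function.update x i y) i)) := by
        intro s' hs' y
        simp only [G, A, hup]
        rw [← Finset.add_sum_erase _ _ (Finset.mem_univ i), add_comm, Real.exp_add,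
          ENNReal.ofReal_mul (Real.exp_pos _).le, mul_assoc]
        congr 4
        refine Finset.sum_congr rfl fun j hj => ?_
        have hj' := Finset.ne_of_mem_erase hj
        simp only [e, hup, hs' j hj', Function.update_of_ne hj']
      calc ∫⁻ y, G (insert i s) (Function.update x i y) ∂μ
          = ∫⁻ y, A y.1 * ENNReal.ofReal (Real.exp (t (u y.1) i * y.2)) ∂μ := by
            refine lintegral_congr fun y => ?_
            rw [hsum _ (fun j hj => by simp [hj]) y]
            simp [e, hup]
        _ ≤ _ := h1
        _ = ∫⁻ y, G s (Function.update x i y) ∂μ := by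
            refine lintegral_congr fun y => ?_
            rw [hsum _ (fun j hj => Iff.rfl) y]
            simp [e, hup, hi]
  simpa [G, e, Finset.mul_sum] using key Finset.univ

end IsNoiseCoupling

/-! ### Log-partition functions of bounded potentials -/

section LogPartition

variable {Λ : Type*} [MeasurableSpace Λ] {π : Measure Λ} [IsProbabilityMeasure π]

lemma integrable_of_abs_le {μ : Measure Λ} [IsFiniteMeasure μ] {u : Λ → ℝ} (hu : Measurable u)
    {K : ℝ} (hK : ∀ lam, |u lam| ≤ K) : Integrable u μ :=
  Integrable.of_bound hu.aestronglyMeasurable K (ae_of_all _ hK)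

lemma integrable_exp_of_abs_le {u : Λ → ℝ} (hu : Measurable u) {K : ℝ}
    (hK : ∀ lam, |u lam| ≤ K) : Integrable (fun lam => Real.exp (u lam)) π :=
  integrable_of_abs_le hu.exp (K := Real.exp K) fun lam => by
    rw [abs_of_pos (Real.exp_pos _)]
    exact Real.exp_le_exp.2 ((le_abs_self _).trans (hK lam))

lemma integral_exp_pos_of_abs_le {u : Λ → ℝ} (hu : Measurable u) {K : ℝ}
    (hK : ∀ lam, |u lam| ≤ K) : 0 < ∫ lam, Real.exp (u lam) ∂π :=
  integral_exp_pos (integrable_exp_of_abs_le hu hK)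

lemma abs_log_integral_exp_le {u : Λ → ℝ} (hu : Measurable u) {K : ℝ}
    (hK : ∀ lam, |u lam| ≤ K) : |Real.log (∫ lam, Real.exp (u lam) ∂π)| ≤ K := by
  have hi := integrable_exp_of_abs_le (π := π) hu hK
  have hp := integral_exp_pos_of_abs_le (π := π) hu hK
  rw [abs_le]
  constructor
  · rw [Real.le_log_iff_exp_le hp]
    calc Real.exp (-K) = ∫ _, Real.exp (-K) ∂π := by simp
      _ ≤ _ := integral_mono (integrable_const _) hi fun lam =>
        Real.exp_le_exp.2 (abs_le.1 (hK lam)).1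
  · rw [Real.log_le_iff_le_exp hp]
    calc _ ≤ ∫ _, Real.exp K ∂π := integral_mono hi (integrable_const _) fun lam =>
        Real.exp_le_exp.2 (abs_le.1 (hK lam)).2
      _ = Real.exp K := by simp

/-- Jensen for the power `s`, in the form of Bernoulli's inequality. After normalising by `a`,
`exp(s(u - a)) ≥ 1 + s(exp(u - a) - 1)`, and the right-hand side integrates to `1`. -/
lemma mul_log_integral_exp_le {u : Λ → ℝ} (hu : Measurable u) {K : ℝ}
    (hK : ∀ lam, |u lam| ≤ K) {s : ℝ} (hs : 1 ≤ s) :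
    s * Real.log (∫ lam, Real.exp (u lam) ∂π) ≤ Real.log (∫ lam, Real.exp (s * u lam) ∂π) := by
  set a := Real.log (∫ lam, Real.exp (u lam) ∂π) with ha
  have hi := integrable_exp_of_abs_le (π := π) hu hK
  have hp := integral_exp_pos_of_abs_le (π := π) hu hK
  have hsK : ∀ lam, |s * u lam| ≤ s * K := fun lam => by
    rw [abs_mul, abs_of_nonneg (by linarith)]
    exact mul_le_mul_of_nonneg_left (hK lam) (by linarith)
  have hsm : Measurable fun lam => s * u lam := by fun_prop
  rw [Real.le_log_iff_exp_le (integral_exp_pos_of_abs_le hsm hsK)]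
  have key : ∀ lam, Real.exp (s * a) * (1 + s * (Real.exp (u lam) / Real.exp a - 1)) ≤
      Real.exp (s * u lam) := fun lam => by
    have h1 := one_add_mul_self_le_rpow_one_add
      (s := Real.exp (u lam) / Real.exp a - 1) (by
        have := div_pos (Real.exp_pos (u lam)) (Real.exp_pos a); linarith) hs
    have h2 : (1 + (Real.exp (u lam) / Real.exp a - 1)) = Real.exp (u lam - a) := by
      rw [Real.exp_sub]; ring
    rw [h2, ← Real.exp_mul] at h1
    calc _ ≤ Real.exp (s * a) * Real.exp ((u lam - a) * s) :=
          mul_le_mul_of_nonneg_left h1 (Real.exp_pos _).le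
      _ = _ := by rw [← Real.exp_add]; ring_nf
  have hea : Real.exp a = ∫ lam, Real.exp (u lam) ∂π := Real.exp_log hp
  have hsplit : ∀ lam, Real.exp (s * a) * (1 + s * (Real.exp (u lam) / Real.exp a - 1)) =
      Real.exp (s * a) * (s / Real.exp a) * Real.exp (u lam) + Real.exp (s * a) * (1 - s) :=
    fun lam => by ring
  simp only [hsplit] at key
  calc Real.exp (s * a)
      = ∫ lam, (Real.exp (s * a) * (s / Real.exp a) * Real.exp (u lam) +
          Real.exp (s * a) * (1 - s)) ∂π := by
        rw [integral_add (hi.const_mul _) (integrable_const _), integral_const_mul, ← hea]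
        simp only [integral_const, probReal_univ, one_smul]
        field_simp
        ring
    _ ≤ _ := integral_mono ((hi.const_mul _).add (integrable_const _))
        (integrable_exp_of_abs_le hsm hsK) key

/-- The easy half of the Gibbs variational principle, with the relative entropy replaced by a bound
`e^B` on the density: Jensen under `p`, then domination by `π`. -/
lemma integral_sub_le_log_integral_exp {u : Λ → ℝ} (hu : Measurable u) {K : ℝ}
    (hK : ∀ lam, |u lam| ≤ K) {p : Measure Λ} [IsProbabilityMeasure p] {B : ℝ}
    (hp : p ≤ ENNReal.ofReal (Real.exp B) • π) :
    ∫ lam, u lam ∂p - B ≤ Real.log (∫ lam, Real.exp (u lam) ∂π) := by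
  have hi := integrable_exp_of_abs_le (π := π) hu hK
  have hip := integrable_exp_of_abs_le (π := p) hu hK
  have hpos := integral_exp_pos_of_abs_le (π := π) hu hK
  rw [Real.le_log_iff_exp_le hpos]
  have h1 : Real.exp (∫ lam, u lam ∂p) ≤ ∫ lam, Real.exp (u lam) ∂p :=
    convexOn_exp.map_integral_le Real.continuous_exp.continuousOn isClosed_univ
      (ae_of_all _ fun _ => Set.mem_univ _) (integrable_of_abs_le hu hK) hip
  have h2 : ∫ lam, Real.exp (u lam) ∂p ≤ Real.exp B * ∫ lam, Real.exp (u lam) ∂π := by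
    have := integral_mono_measure hp (ae_of_all _ fun lam => (Real.exp_pos (u lam)).le)
      (hi.smul_measure ENNReal.ofReal_ne_top)
    rwa [integral_smul_measure, ENNReal.toReal_ofReal (Real.exp_pos _).le, smul_eq_mul] at this
  rw [Real.exp_sub, div_le_iff₀' (Real.exp_pos _)]
  exact h1.trans h2

end LogPartition

/-! ### Gibbs densities for the squared loss -/

/-- The potential `-(s ‖w‖² - 2 ⟨x, w⟩) / β`. -/
def potential {n : ℕ} (β s : ℝ) (x w : Fin n → ℝ) : ℝ :=
  -(β⁻¹ * ∑ i, (s * w i ^ 2 - 2 * x i * w i))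

/-- The logarithm of the normalising constant of the Gibbs measure. -/
def logPartition {Λ : Type*} [MeasurableSpace Λ] {n : ℕ} (π : Measure Λ) (h : Λ → Fin n → ℝ)
    (β s : ℝ) (x : Fin n → ℝ) : ℝ :=
  Real.log (∫ lam, Real.exp (potential β s x (h lam)) ∂π)

/-- The density of the Gibbs measure with respect to the prior. -/
def gibbsDensity {Λ : Type*} [MeasurableSpace Λ] {n : ℕ} (π : Measure Λ) (h : Λ → Fin n → ℝ)
    (β : ℝ) (x : Fin n → ℝ) (lam : Λ) : ℝ :=
  Real.exp (potential β 1 x (h lam) - logPartition π h β 1 x)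

/-- The mean of `h` under the Gibbs measure. -/
def gibbsMean {Λ : Type*} [MeasurableSpace Λ] {n : ℕ} (π : Measure Λ) (h : Λ → Fin n → ℝ)
    (β : ℝ) (x : Fin n → ℝ) (i : Fin n) : ℝ :=
  ∫ lam, gibbsDensity π h β x lam * h lam i ∂π

section Gibbs

variable {n : ℕ}

lemma potential_add (β s s' : ℝ) (x x' w : Fin n → ℝ) :
    potential β (s + s') (x + x') w = potential β s x w + potential β s' x' w := by
  simp only [potential, Pi.add_apply, ← neg_add, ← mul_add, ← Finset.sum_add_distrib]
  congr 2
  exact Finset.sum_congr rfl fun i _ => by ring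

lemma potential_smul (β s c : ℝ) (x w : Fin n → ℝ) :
    potential β (c * s) (fun i => c * x i) w = c * potential β s x w := by
  simp only [potential, mul_neg]
  rw [mul_left_comm, Finset.mul_sum (a := c)]
  congr 2
  exact Finset.sum_congr rfl fun i _ => by ring

lemma abs_potential_le {β s C : ℝ} (hβ : 0 < β) (x : Fin n → ℝ) {w : Fin n → ℝ}
    (hw : ∀ i, |w i| ≤ C) :
    |potential β s x w| ≤ β⁻¹ * ∑ i, (|s| * C ^ 2 + 2 * C * |x i|) := by
  rw [potential, abs_neg, abs_mul, abs_of_pos (inv_pos.2 hβ)]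
  refine mul_le_mul_of_nonneg_left ((Finset.abs_sum_le_sum_abs _ _).trans
    (Finset.sum_le_sum fun i _ => ?_)) (inv_pos.2 hβ).le
  have h0 := abs_nonneg (w i)
  have h1 : w i ^ 2 ≤ C ^ 2 := by
    rw [← sq_abs]; exact pow_le_pow_left₀ h0 (hw i) 2
  refine (abs_sub _ _).trans (add_le_add ?_ ?_)
  · rw [abs_mul, abs_of_nonneg (sq_nonneg (w i))]
    exact mul_le_mul_of_nonneg_left h1 (abs_nonneg s)
  · rw [abs_mul, abs_mul, abs_two]
    nlinarith [mul_le_mul_of_nonneg_left (hw i) (abs_nonneg (x i))]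

lemma measurable_potential {Ω : Type*} [MeasurableSpace Ω] (β s : ℝ) {x w : Ω → Fin n → ℝ}
    (hx : Measurable x) (hw : Measurable w) : Measurable fun ω => potential β s (x ω) (w ω) := by
  unfold potential
  fun_prop

variable {Λ : Type*} [MeasurableSpace Λ] {π : Measure Λ} [IsProbabilityMeasure π]
  {h : Λ → Fin n → ℝ} {β C L : ℝ}

lemma measurable_logPartition (hm : Measurable h) (s : ℝ) :
    Measurable (logPartition π h β s) := by
  have : Measurable fun q : (Fin n → ℝ) × Λ => Real.exp (potential β s q.1 (h q.2)) :=
    (measurable_potential β s measurable_fst (hm.comp measurable_snd)).exp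
  exact (this.stronglyMeasurable.integral_prod_right (ν := π)).measurable.log

lemma measurable_gibbsDensity (hm : Measurable h) :
    Measurable fun q : (Fin n → ℝ) × Λ => gibbsDensity π h β q.1 q.2 := by
  unfold gibbsDensity
  exact ((measurable_potential β 1 measurable_fst (hm.comp measurable_snd)).sub
    ((measurable_logPartition hm 1).comp measurable_fst)).exp

lemma measurable_gibbsDensity_comp (hm : Measurable h) {Ω : Type*} [MeasurableSpace Ω]
    {x : Ω → Fin n → ℝ} {l : Ω → Λ} (hx : Measurable x) (hl : Measurable l) :
    Measurable fun ω => gibbsDensity π h β (x ω) (l ω) := by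
  unfold gibbsDensity
  exact ((measurable_potential β 1 hx (hm.comp hl)).sub
    ((measurable_logPartition hm 1).comp hx)).exp

lemma measurable_gibbsMean (hm : Measurable h) : Measurable (gibbsMean π h β) := by
  refine measurable_pi_iff.2 fun i => ?_
  have h1 : Measurable fun q : (Fin n → ℝ) × Λ => h q.2 i := by fun_prop
  have : Measurable fun q : (Fin n → ℝ) × Λ => gibbsDensity π h β q.1 q.2 * h q.2 i :=
    (measurable_gibbsDensity hm).mul h1
  exact (this.stronglyMeasurable.integral_prod_right (ν := π)).measurable

omit [IsProbabilityMeasure π] in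
lemma gibbsDensity_pos (x : Fin n → ℝ) (lam : Λ) : 0 < gibbsDensity π h β x lam :=
  Real.exp_pos _

lemma abs_logPartition_le (hm : Measurable h) (hβ : 0 < β) (hC : ∀ lam i, |h lam i| ≤ C)
    (s : ℝ) (x : Fin n → ℝ) :
    |logPartition π h β s x| ≤ β⁻¹ * ∑ i, (|s| * C ^ 2 + 2 * C * |x i|) :=
  abs_log_integral_exp_le (measurable_potential β s measurable_const hm)
    fun lam => abs_potential_le hβ x (hC lam)

lemma integrable_logPartition {Ω : Type*} [MeasurableSpace Ω] {P : Measure Ω} [IsFiniteMeasure P]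
    (hm : Measurable h) (hβ : 0 < β) (hC : ∀ lam i, |h lam i| ≤ C)
    (s : ℝ) {x : Ω → Fin n → ℝ} (hx : Measurable x) (hxi : ∀ i, Integrable (fun ω => x ω i) P) :
    Integrable (fun ω => logPartition π h β s (x ω)) P := by
  refine Integrable.mono' (g := fun ω => β⁻¹ * ∑ i, (|s| * C ^ 2 + 2 * C * |x ω i|)) ?_
    ((measurable_logPartition hm s).comp hx).aestronglyMeasurable
    (ae_of_all _ fun ω => abs_logPartition_le hm hβ hC s (x ω))
  exact (integrable_finsetSum _ fun i _ =>
    (integrable_const _).add ((hxi i).abs.const_mul _)).const_mul _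

lemma integrable_gibbsDensity_mul (hm : Measurable h) (hβ : 0 < β) (hC : ∀ lam i, |h lam i| ≤ C)
    (x : Fin n → ℝ) {u : Λ → ℝ} (hu : Measurable u) {K : ℝ} (hK : ∀ lam, |u lam| ≤ K) :
    Integrable (fun lam => gibbsDensity π h β x lam * u lam) π := by
  refine (integrable_exp_of_abs_le (u := fun lam => potential β 1 x (h lam) -
    logPartition π h β 1 x) ?_ (K := β⁻¹ * ∑ i, (|1| * C ^ 2 + 2 * C * |x i|) +
      |logPartition π h β 1 x|) ?_).mul_bdd (c := K) hu.aestronglyMeasurable (ae_of_all _ hK)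
  · exact (measurable_potential β 1 measurable_const hm).sub measurable_const
  · exact fun lam => (abs_sub _ _).trans
      (add_le_add (abs_potential_le hβ x (hC lam)) le_rfl)

lemma integral_gibbsDensity (hm : Measurable h) (hβ : 0 < β) (hC : ∀ lam i, |h lam i| ≤ C)
    (x : Fin n → ℝ) : ∫ lam, gibbsDensity π h β x lam ∂π = 1 := by
  have hpos := integral_exp_pos_of_abs_le (π := π) (measurable_potential β 1 measurable_const hm)
    fun lam => abs_potential_le hβ x (hC lam)
  simp only [gibbsDensity, Real.exp_sub]
  rw [integral_div, logPartition, Real.exp_log hpos, div_self hpos.ne']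

lemma integral_gibbsDensity_mul_le (hm : Measurable h) (hβ : 0 < β)
    (hC : ∀ lam i, |h lam i| ≤ C) (x : Fin n → ℝ) {u : Λ → ℝ} (hu : Measurable u) {K : ℝ}
    (hK : ∀ lam, |u lam| ≤ K) : |∫ lam, gibbsDensity π h β x lam * u lam ∂π| ≤ K := by
  have h1 : Integrable (gibbsDensity π h β x) π := by
    simpa using integrable_gibbsDensity_mul (π := π) hm hβ hC x (u := fun _ => 1) (by fun_prop)
      (K := 1) (by simp)
  calc _ ≤ ∫ lam, |gibbsDensity π h β x lam * u lam| ∂π := abs_integral_le_integral_abs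
    _ ≤ ∫ lam, gibbsDensity π h β x lam * K ∂π := by
      refine integral_mono (integrable_gibbsDensity_mul hm hβ hC x hu hK).abs (h1.mul_const _)
        fun lam => ?_
      rw [abs_mul, abs_of_pos (gibbsDensity_pos x lam)]
      exact mul_le_mul_of_nonneg_left (hK lam) (gibbsDensity_pos x lam).le
    _ = K := by rw [integral_mul_const, integral_gibbsDensity hm hβ hC, one_mul]

lemma abs_gibbsMean_le (hm : Measurable h) (hβ : 0 < β) (hC : ∀ lam i, |h lam i| ≤ C)
    (x : Fin n → ℝ) (i : Fin n) : |gibbsMean π h β x i| ≤ C :=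
  integral_gibbsDensity_mul_le hm hβ hC x (by fun_prop) fun lam => hC lam i

lemma abs_sub_gibbsMean_le (hm : Measurable h) (hβ : 0 < β) (hC : ∀ lam i, |h lam i| ≤ C)
    (hL : ∀ lam lam' i, |h lam i - h lam' i| ≤ L) (x : Fin n → ℝ) (lam : Λ) (i : Fin n) :
    |h lam i - gibbsMean π h β x i| ≤ L := by
  have h1 := integral_gibbsDensity_mul_le (π := π) hm hβ hC x
    (u := fun lam' => h lam i - h lam' i) (by fun_prop) fun lam' => hL lam lam' i
  have h2 : ∫ lam', gibbsDensity π h β x lam' * (h lam i - h lam' i) ∂π =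
      h lam i - gibbsMean π h β x i := by
    simp only [mul_sub]
    rw [integral_sub (integrable_gibbsDensity_mul hm hβ hC x (by fun_prop) fun _ => le_rfl)
      (integrable_gibbsDensity_mul hm hβ hC x (by fun_prop) fun lam' => hC lam' i),
      integral_mul_const, integral_gibbsDensity hm hβ hC, one_mul, gibbsMean]
  rwa [h2] at h1

/-- Factoring out the Gibbs density at `x` and centring `h` at its Gibbs mean gives an exact formula
whose remainder is the logarithm of an average; the only loss is `log X ≤ X - 1`, which makes the
remainder linear so that it can be averaged over the noise. -/
lemma logPartition_add_le (hm : Measurable h) (hβ : 0 < β) (hC : ∀ lam i, |h lam i| ≤ C)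
    (γ : ℝ) (x z : Fin n → ℝ) :
    logPartition π h β (1 + γ) (x + z) ≤ logPartition π h β 1 x +
      2 * β⁻¹ * ∑ i, gibbsMean π h β x i * z i +
      (∫ lam, gibbsDensity π h β x lam * (Real.exp (-(β⁻¹ * γ * ∑ i, h lam i ^ 2)) *
        Real.exp (∑ i, 2 * β⁻¹ * (h lam i - gibbsMean π h β x i) * z i)) ∂π) - 1 := by
  set a := logPartition π h β 1 x with ha
  set m := 2 * β⁻¹ * ∑ i, gibbsMean π h β x i * z i with hmdef
  set X := ∫ lam, gibbsDensity π h β x lam * (Real.exp (-(β⁻¹ * γ * ∑ i, h lam i ^ 2)) *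
        Real.exp (∑ i, 2 * β⁻¹ * (h lam i - gibbsMean π h β x i) * z i)) ∂π with hX
  have hpt : ∀ lam, Real.exp (potential β (1 + γ) (x + z) (h lam)) = Real.exp (a + m) *
      (gibbsDensity π h β x lam * (Real.exp (-(β⁻¹ * γ * ∑ i, h lam i ^ 2)) *
        Real.exp (∑ i, 2 * β⁻¹ * (h lam i - gibbsMean π h β x i) * z i))) := fun lam => by
    rw [potential_add, gibbsDensity, ← Real.exp_add, ← Real.exp_add, ← Real.exp_add, ← ha]
    congr 1
    have : potential β γ z (h lam) = m + (-(β⁻¹ * γ * ∑ i, h lam i ^ 2) +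
        ∑ i, 2 * β⁻¹ * (h lam i - gibbsMean π h β x i) * z i) := by
      simp only [potential, hmdef, Finset.mul_sum, ← Finset.sum_neg_distrib,
        ← Finset.sum_add_distrib]
      exact Finset.sum_congr rfl fun i _ => by ring
    rw [this]; ring
  have hint : ∫ lam, Real.exp (potential β (1 + γ) (x + z) (h lam)) ∂π = Real.exp (a + m) * X := by
    rw [hX, ← integral_const_mul]
    exact integral_congr_ae (ae_of_all _ hpt)
  have hpos := integral_exp_pos_of_abs_le (π := π)
    (measurable_potential β (1 + γ) measurable_const hm)
    fun lam => abs_potential_le hβ (x + z) (hC lam)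
  rw [hint] at hpos
  have hXpos : 0 < X := pos_of_mul_pos_right hpos (Real.exp_pos _).le
  rw [logPartition, hint, Real.log_mul (Real.exp_pos _).ne' hXpos.ne', Real.log_exp]
  linarith [Real.log_le_sub_one_of_pos hXpos]

end Gibbs

/-! ### The oracle inequality for bounded families -/

section Oracle

variable {n : ℕ} {Λ : Type*} [MeasurableSpace Λ] {π : Measure Λ} [IsProbabilityMeasure π]
  {h : Λ → Fin n → ℝ} {β C L : ℝ} {ν : Measure ℝ} [IsProbabilityMeasure ν]

lemma abs_linearized_loss_le (hβ : 0 < β) {ε : ℝ} (hε0 : 0 ≤ ε) (hε1 : ε ≤ 1)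
    {w m : Fin n → ℝ} (hw : ∀ i, |w i| ≤ C) (hm : ∀ i, |m i| ≤ C) :
    |β⁻¹ * ∑ i, (-(2 * m i) * w i + m i ^ 2 + ε * L ^ 2)| ≤
      β⁻¹ * (n * (3 * C ^ 2 + L ^ 2)) := by
  rw [abs_mul, abs_of_pos (inv_pos.2 hβ)]
  refine mul_le_mul_of_nonneg_left ?_ (inv_pos.2 hβ).le
  have : ∀ i ∈ Finset.univ, |-(2 * m i) * w i + m i ^ 2 + ε * L ^ 2| ≤ 3 * C ^ 2 + L ^ 2 := by
    intro i _
    have h1 := abs_le.1 (hw i)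
    have h2 := abs_le.1 (hm i)
    have h3 : |m i * w i| ≤ C * C := by
      rw [abs_mul]
      exact mul_le_mul (hm i) (hw i) (abs_nonneg _) ((abs_nonneg _).trans (hm i))
    have h3' := abs_le.1 h3
    have h4 : m i ^ 2 ≤ C ^ 2 := by rw [← sq_abs]; exact pow_le_pow_left₀ (abs_nonneg _) (hm i) 2
    have h5 : ε * L ^ 2 ≤ L ^ 2 := mul_le_of_le_one_left (sq_nonneg _) hε1
    have h6 : 0 ≤ ε * L ^ 2 := mul_nonneg hε0 (sq_nonneg _)
    rw [abs_le]
    constructor <;> nlinarith [sq_nonneg (m i)]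
  calc _ ≤ ∑ i, |-(2 * m i) * w i + m i ^ 2 + ε * L ^ 2| := Finset.abs_sum_le_sum_abs _ _
    _ ≤ ∑ _i : Fin n, (3 * C ^ 2 + L ^ 2) := Finset.sum_le_sum this
    _ = _ := by simp [mul_add]

/-- The Gibbs average of `-2 m h + m²` is `-m²`. This is where the squared error of the aggregate
appears, with a negative sign. -/
lemma integral_gibbsDensity_mul_linearized_loss (hm : Measurable h) (hβ : 0 < β)
    (hC : ∀ lam i, |h lam i| ≤ C) (ε γ c : ℝ) (x : Fin n → ℝ) :
    ∫ lam, gibbsDensity π h β x lam * (c + γ * (β⁻¹ * ∑ i, (-(2 * gibbsMean π h β x i) * h lam i +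
        gibbsMean π h β x i ^ 2 + ε * L ^ 2))) ∂π =
      c + γ * (β⁻¹ * (ε * (n * L ^ 2) - ∑ i, gibbsMean π h β x i ^ 2)) := by
  have hr : Integrable (fun lam => gibbsDensity π h β x lam) π := by
    simpa using integrable_gibbsDensity_mul (π := π) hm hβ hC x (u := fun _ => 1) (by fun_prop)
      (K := 1) (by simp)
  have hi : ∀ i, Integrable (fun lam => gibbsDensity π h β x lam * h lam i) π := fun i =>
    integrable_gibbsDensity_mul hm hβ hC x (by fun_prop) fun lam => hC lam i
  have hterm : ∀ i, Integrable (fun lam => -(2 * gibbsMean π h β x i) *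
      (gibbsDensity π h β x lam * h lam i) + (gibbsMean π h β x i ^ 2 + ε * L ^ 2) *
        gibbsDensity π h β x lam) π := fun i => ((hi i).const_mul _).add (hr.const_mul _)
  have h1 : ∀ lam, gibbsDensity π h β x lam * (c + γ * (β⁻¹ *
      ∑ i, (-(2 * gibbsMean π h β x i) * h lam i + gibbsMean π h β x i ^ 2 + ε * L ^ 2))) =
      c * gibbsDensity π h β x lam + γ * β⁻¹ * ∑ i, (-(2 * gibbsMean π h β x i) *
        (gibbsDensity π h β x lam * h lam i) + (gibbsMean π h β x i ^ 2 + ε * L ^ 2) *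
          gibbsDensity π h β x lam) := fun lam => by
    rw [mul_add, mul_left_comm _ γ, mul_left_comm _ β⁻¹, Finset.mul_sum, mul_assoc γ, mul_comm c]
    congr 3
    exact Finset.sum_congr rfl fun i _ => by ring
  simp only [h1]
  rw [integral_add (hr.const_mul _) ((integrable_finsetSum _ fun i _ => hterm i).const_mul _),
    integral_const_mul, integral_const_mul, integral_finsetSum _ fun i _ => hterm i,
    integral_gibbsDensity hm hβ hC, mul_one, mul_assoc]
  congr 3
  have h2 : ∀ i, ∫ lam, (-(2 * gibbsMean π h β x i) *
      (gibbsDensity π h β x lam * h lam i) + (gibbsMean π h β x i ^ 2 + ε * L ^ 2) *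
        gibbsDensity π h β x lam) ∂π = ε * L ^ 2 - gibbsMean π h β x i ^ 2 := fun i => by
    rw [integral_add ((hi i).const_mul _) (hr.const_mul _), integral_const_mul,
      integral_const_mul, integral_gibbsDensity hm hβ hC, ← gibbsMean]
    ring
  simp only [h2, Finset.sum_sub_distrib]
  simp only [Finset.sum_const, Finset.card_univ, Fintype.card_fin, nsmul_eq_mul]
  ring

/-- The exponential moment of the increment of the log-partition function along a coupling. -/
lemma IsNoiseCoupling.lintegral_increment_le {μ : Measure (ℝ × ℝ)} {γ ε : ℝ}
    (hμ : IsNoiseCoupling ν μ γ (2 * β⁻¹ * L) ((1 + ε) * γ * (β / 4)))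
    (hm : Measurable h) (hβ : 0 < β) (hC : ∀ lam i, |h lam i| ≤ C)
    (hL : ∀ lam lam' i, |h lam i - h lam' i| ≤ L)
    (hγ : 0 < γ) (hε0 : 0 ≤ ε) (hε1 : ε ≤ 1) {K : ℝ} (hK : β⁻¹ * (n * (3 * C ^ 2 + L ^ 2)) ≤ K)
    (hγK : γ * K ≤ 1) :
    ∫⁻ p : Fin n → ℝ × ℝ, ∫⁻ lam, ENNReal.ofReal (gibbsDensity π h β (fun j => (p j).1) lam *
        (Real.exp (-(β⁻¹ * γ * ∑ i, h lam i ^ 2)) * Real.exp (∑ i, 2 * β⁻¹ *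
          (h lam i - gibbsMean π h β (fun j => (p j).1) i) * (p i).2))) ∂π
            ∂(Measure.pi fun _ => μ) ≤
      ∫⁻ x, ENNReal.ofReal (1 + (γ * K) ^ 2 + γ * (β⁻¹ * (ε * (n * L ^ 2) -
        ∑ i, gibbsMean π h β x i ^ 2))) ∂(Measure.pi fun _ : Fin n => ν) := by
  have := hμ.isProbabilityMeasure
  have hrm := measurable_gibbsDensity (π := π) (β := β) hm
  have hgm := measurable_gibbsMean (π := π) (β := β) hm
  have hfst : Measurable fun p : Fin n → ℝ × ℝ => fun j => (p j).1 := by fun_prop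
  have hrp : Measurable fun q : (Fin n → ℝ × ℝ) × Λ =>
      gibbsDensity π h β (fun j => (q.1 j).1) q.2 :=
    measurable_gibbsDensity_comp hm (hfst.comp measurable_fst) measurable_snd
  have hgp : Measurable fun q : (Fin n → ℝ × ℝ) × Λ =>
      gibbsMean π h β (fun j => (q.1 j).1) := by fun_prop
  -- The exponent after averaging over `ζ` is `γ/β` times the sum of `-h² + (1+ε)(h-m)²`; here `-h²
  -- + (h-m)² = -2mh + m²`, and `ε L²` dominates `ε (h-m)²`.
  let W : (Fin n → ℝ) → Λ → ℝ := fun x lam => β⁻¹ * ∑ i, (-(2 * gibbsMean π h β x i) * h lam i +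
        gibbsMean π h β x i ^ 2 + ε * L ^ 2)
  have hWK : ∀ x lam, |W x lam| ≤ K := fun x lam =>
    (abs_linearized_loss_le hβ hε0 hε1 (hC lam) (abs_gibbsMean_le hm hβ hC x)).trans hK
  have hWm : Measurable fun q : (Fin n → ℝ) × Λ => W q.1 q.2 := by
    simp only [W]
    fun_prop
  have hexp : ∀ x lam, Real.exp (-(β⁻¹ * γ * ∑ i, h lam i ^ 2)) *
      Real.exp ((1 + ε) * γ * (β / 4) * ∑ i, (2 * β⁻¹ * (h lam i - gibbsMean π h β x i)) ^ 2) ≤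
        1 + (γ * K) ^ 2 + γ * W x lam := fun x lam => by
    have h1 : -(β⁻¹ * γ * ∑ i, h lam i ^ 2) + (1 + ε) * γ * (β / 4) *
        ∑ i, (2 * β⁻¹ * (h lam i - gibbsMean π h β x i)) ^ 2 ≤ γ * W x lam := by
      simp only [W, Finset.mul_sum]
      rw [← Finset.sum_neg_distrib, ← Finset.sum_add_distrib]
      refine Finset.sum_le_sum fun i _ => ?_
      have h2 : (h lam i - gibbsMean π h β x i) ^ 2 ≤ L ^ 2 := by
        rw [← sq_abs]
        exact pow_le_pow_left₀ (abs_nonneg _) (abs_sub_gibbsMean_le hm hβ hC hL x lam i) 2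
      -- The calibration of the temperature: the variance proxy `β/4` times the squared slope
      -- `(2/β)²` is exactly `1/β`.
      have h3 : (1 + ε) * γ * (β / 4) * (2 * β⁻¹ * (h lam i - gibbsMean π h β x i)) ^ 2 =
          γ * (β⁻¹ * ((1 + ε) * (h lam i - gibbsMean π h β x i) ^ 2)) := by
        field_simp; ring
      have h4 : -(β⁻¹ * γ * h lam i ^ 2) = γ * (β⁻¹ * (-h lam i ^ 2)) := by ring
      rw [h3, h4, ← mul_add, ← mul_add]
      refine mul_le_mul_of_nonneg_left (mul_le_mul_of_nonneg_left ?_ (inv_pos.2 hβ).le) hγ.le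
      nlinarith [mul_le_mul_of_nonneg_left h2 hε0]
    have h5 : |γ * W x lam| ≤ γ * K := by
      rw [abs_mul, abs_of_pos hγ]; exact mul_le_mul_of_nonneg_left (hWK x lam) hγ.le
    have h6 := abs_le.1 (Real.abs_exp_sub_one_sub_id_le (h5.trans hγK))
    have h7 : (γ * W x lam) ^ 2 ≤ (γ * K) ^ 2 := by
      rw [← sq_abs]; exact pow_le_pow_left₀ (abs_nonneg _) h5 2
    rw [← Real.exp_add]
    linarith [Real.exp_le_exp.2 h1, h6.2]
  -- Tonelli freezes `λ`, so that the coupling bound applies with a weight depending only on the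
  -- first components; a second swap restores the Gibbs average.
  calc _ = ∫⁻ lam, ∫⁻ p : Fin n → ℝ × ℝ,
        ENNReal.ofReal (gibbsDensity π h β (fun j => (p j).1) lam *
          Real.exp (-(β⁻¹ * γ * ∑ i, h lam i ^ 2))) *
        ENNReal.ofReal (Real.exp (∑ i, 2 * β⁻¹ *
          (h lam i - gibbsMean π h β (fun j => (p j).1) i) * (p i).2))
            ∂(Measure.pi fun _ => μ) ∂π := by
        rw [lintegral_lintegral_swap]
        · refine lintegral_congr fun lam => lintegral_congr fun p => ?_
          rw [← ENNReal.ofReal_mul (mul_pos (gibbsDensity_pos _ _) (Real.exp_pos _)).le]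
          congr 1
          ring
        · simp only [Function.uncurry_def]
          exact Measurable.aemeasurable (by fun_prop)
    _ ≤ ∫⁻ lam, ∫⁻ p : Fin n → ℝ × ℝ, ENNReal.ofReal
          (gibbsDensity π h β (fun j => (p j).1) lam *
            (1 + (γ * K) ^ 2 + γ * W (fun j => (p j).1) lam)) ∂(Measure.pi fun _ => μ) ∂π := by
        refine lintegral_mono fun lam => ?_
        have hr1 : Measurable fun x => gibbsDensity π h β x lam :=
          measurable_gibbsDensity_comp hm measurable_id measurable_const
        refine (hμ.lintegral_exp_pi_le (D := fun x => ENNReal.ofReal (gibbsDensity π h β x lam *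
          Real.exp (-(β⁻¹ * γ * ∑ i, h lam i ^ 2))))
          (t := fun x i => 2 * β⁻¹ * (h lam i - gibbsMean π h β x i)) (by fun_prop)
          (by fun_prop) fun x i => ?_).trans ?_
        · rw [abs_mul, abs_of_pos (by positivity)]
          exact mul_le_mul_of_nonneg_left (abs_sub_gibbsMean_le hm hβ hC hL x lam i)
            (by positivity)
        · refine lintegral_mono fun p => ?_
          rw [← ENNReal.ofReal_mul (mul_pos (gibbsDensity_pos _ _) (Real.exp_pos _)).le, mul_assoc]
          exact ENNReal.ofReal_le_ofReal
            (mul_le_mul_of_nonneg_left (hexp _ lam) (gibbsDensity_pos _ _).le)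
    _ = ∫⁻ lam, ∫⁻ x, ENNReal.ofReal
          (gibbsDensity π h β x lam * (1 + (γ * K) ^ 2 + γ * W x lam))
            ∂(Measure.pi fun _ => ν) ∂π := by
        refine lintegral_congr fun lam => ?_
        have hr1 : Measurable fun x => gibbsDensity π h β x lam :=
          measurable_gibbsDensity_comp hm measurable_id measurable_const
        have hW1 : Measurable fun x => W x lam := by simp only [W]; fun_prop
        rw [← hμ.map_fst_pi, lintegral_map (by fun_prop) hfst]
    _ = ∫⁻ x, ∫⁻ lam, ENNReal.ofReal
          (gibbsDensity π h β x lam * (1 + (γ * K) ^ 2 + γ * W x lam))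
            ∂π ∂(Measure.pi fun _ => ν) := by
        rw [lintegral_lintegral_swap]
        have hr2 : Measurable fun q : Λ × (Fin n → ℝ) => gibbsDensity π h β q.2 q.1 :=
          measurable_gibbsDensity_comp hm measurable_snd measurable_fst
        have hW2 : Measurable fun q : Λ × (Fin n → ℝ) => W q.2 q.1 := by simp only [W]; fun_prop
        simp only [Function.uncurry_def]
        exact Measurable.aemeasurable (by fun_prop)
    _ = _ := by
        refine lintegral_congr fun x => ?_
        have hWx : Measurable fun lam => W x lam := by simp only [W]; fun_prop
        rw [← integral_gibbsDensity_mul_linearized_loss hm hβ hC ε γ (1 + (γ * K) ^ 2) x,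
          ofReal_integral_eq_lintegral_ofReal]
        · refine integrable_gibbsDensity_mul hm hβ hC x (by fun_prop)
            (K := |1 + (γ * K) ^ 2| + |γ| * K) fun lam => ?_
          refine (abs_add_le _ _).trans (add_le_add le_rfl ?_)
          rw [abs_mul]
          exact mul_le_mul_of_nonneg_left (hWK x lam) (abs_nonneg _)
        · refine ae_of_all _ fun lam => mul_nonneg (gibbsDensity_pos _ _).le ?_
          exact (mul_pos (Real.exp_pos _) (Real.exp_pos _)).le.trans (hexp x lam)

lemma integrable_gibbsMean_sq (hm : Measurable h) (hβ : 0 < β) (hC : ∀ lam i, |h lam i| ≤ C)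
    {P : Measure (Fin n → ℝ)} [IsFiniteMeasure P] :
    Integrable (fun x => ∑ i, gibbsMean π h β x i ^ 2) P := by
  have hgm := measurable_gibbsMean (π := π) (β := β) hm
  refine integrable_finsetSum _ fun i _ => integrable_of_abs_le (by fun_prop) (K := C ^ 2)
    fun x => ?_
  rw [abs_pow]
  exact pow_le_pow_left₀ (abs_nonneg _) (abs_gibbsMean_le hm hβ hC x i) 2

/-- The mean of `A(1+γ, ξ+ζ)` is bounded on both sides: below through the dilation `(1+γ)ξ`, above
through the expansion around `ξ`. One copy of `E A(1, ξ)` cancels, leaving a factor `γ`. -/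
lemma IsNoiseCoupling.mul_integral_logPartition_le {μ : Measure (ℝ × ℝ)} {γ ε : ℝ}
    (hμ : IsNoiseCoupling ν μ γ (2 * β⁻¹ * L) ((1 + ε) * γ * (β / 4)))
    (hν : Integrable (fun x : ℝ => x) ν)
    (hm : Measurable h) (hβ : 0 < β) (hC : ∀ lam i, |h lam i| ≤ C)
    (hL : ∀ lam lam' i, |h lam i - h lam' i| ≤ L)
    (hγ : 0 < γ) (hε0 : 0 ≤ ε) (hε1 : ε ≤ 1) {K : ℝ} (hK : β⁻¹ * (n * (3 * C ^ 2 + L ^ 2)) ≤ K)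
    (hγK : γ * K ≤ 1) :
    γ * ∫ x, logPartition π h β 1 x ∂(Measure.pi fun _ : Fin n => ν) ≤
      (γ * K) ^ 2 + γ * (β⁻¹ * (ε * (n * L ^ 2) -
        ∫ x, ∑ i, gibbsMean π h β x i ^ 2 ∂(Measure.pi fun _ : Fin n => ν))) := by
  have := hμ.isProbabilityMeasure
  have hgm := measurable_gibbsMean (π := π) (β := β) hm
  have hlm : ∀ s, Measurable (logPartition π h β s) := measurable_logPartition hm
  have hfst : Measurable fun p : Fin n → ℝ × ℝ => fun j => (p j).1 := by fun_prop
  have hadd : Measurable fun p : Fin n → ℝ × ℝ => fun j => (p j).1 + (p j).2 := by fun_prop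
  have hmul : Measurable fun x : Fin n → ℝ => fun j => (1 + γ) * x j := by fun_prop
  have hxi : ∀ i, Integrable (fun x : Fin n → ℝ => x i) (Measure.pi fun _ => ν) := fun i =>
    (measurePreserving_eval (fun _ : Fin n => ν) i).integrable_comp_of_integrable hν
  have hfi : ∀ i, Integrable (fun p : Fin n → ℝ × ℝ => (p i).1) (Measure.pi fun _ => μ) := by
    intro i
    have := hxi i
    rw [← hμ.map_fst_pi] at this
    exact this.comp_measurable hfst
  have hsi := fun i => hμ.integrable_snd_pi (n := n) i
  have hpi := fun i => hμ.integral_mul_snd_pi_eq_zero (n := n) i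
    (b := fun x => gibbsMean π h β x i) (by fun_prop) fun x => abs_gibbsMean_le hm hβ hC x i
  let X : (Fin n → ℝ × ℝ) → Λ → ℝ := fun p lam => gibbsDensity π h β (fun j => (p j).1) lam *
        (Real.exp (-(β⁻¹ * γ * ∑ i, h lam i ^ 2)) * Real.exp (∑ i, 2 * β⁻¹ *
          (h lam i - gibbsMean π h β (fun j => (p j).1) i) * (p i).2))
  have hXpos : ∀ p lam, 0 ≤ X p lam := fun p lam =>
    (mul_pos (gibbsDensity_pos _ _) (mul_pos (Real.exp_pos _) (Real.exp_pos _))).le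
  have hXm : Measurable fun q : (Fin n → ℝ × ℝ) × Λ => X q.1 q.2 := by
    have h1 : Measurable fun q : (Fin n → ℝ × ℝ) × Λ =>
        gibbsDensity π h β (fun j => (q.1 j).1) q.2 :=
      measurable_gibbsDensity_comp hm (hfst.comp measurable_fst) measurable_snd
    have h2 : Measurable fun q : (Fin n → ℝ × ℝ) × Λ =>
      gibbsMean π h β (fun j => (q.1 j).1) := by fun_prop
    simp only [X]
    fun_prop
  have hXim : Measurable fun p => ∫ lam, X p lam ∂π :=
    (hXm.stronglyMeasurable.integral_prod_right (ν := π)).measurable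
  have hb : ∀ p : Fin n → ℝ × ℝ,
      logPartition π h β (1 + γ) (fun j => (p j).1 + (p j).2) ≤
      logPartition π h β 1 (fun j => (p j).1) +
      2 * β⁻¹ * ∑ i, gibbsMean π h β (fun j => (p j).1) i * (p i).2 + ∫ lam, X p lam ∂π - 1 :=
    fun p => logPartition_add_le hm hβ hC γ (fun j => (p j).1) fun j => (p j).2
  set J := ∫ x, ∑ i, gibbsMean π h β x i ^ 2 ∂(Measure.pi fun _ : Fin n => ν) with hJ
  have hint : Integrable (fun x => 1 + (γ * K) ^ 2 + γ * (β⁻¹ * (ε * (n * L ^ 2) -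
        ∑ i, gibbsMean π h β x i ^ 2))) (Measure.pi fun _ : Fin n => ν) :=
    (integrable_const _).add (((((integrable_const _).sub
      (integrable_gibbsMean_sq hm hβ hC)).const_mul _)).const_mul _)
  have hinteq : ∫ x, (1 + (γ * K) ^ 2 + γ * (β⁻¹ * (ε * (n * L ^ 2) -
        ∑ i, gibbsMean π h β x i ^ 2))) ∂(Measure.pi fun _ : Fin n => ν) =
      1 + (γ * K) ^ 2 + γ * (β⁻¹ * (ε * (n * L ^ 2) - J)) := by
    have h1 : Integrable (fun x => ε * (n * L ^ 2) - ∑ i, gibbsMean π h β x i ^ 2)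
        (Measure.pi fun _ : Fin n => ν) :=
      (integrable_const _).sub (integrable_gibbsMean_sq hm hβ hC)
    rw [integral_add (integrable_const _) ((h1.const_mul _).const_mul _), integral_const_mul,
      integral_const_mul, integral_sub (integrable_const _) (integrable_gibbsMean_sq hm hβ hC)]
    simp [hJ]
  -- Needed because `ENNReal.ofReal` truncates negative values; it holds since `γ K ≤ 1`.
  have hnn : ∀ x, 0 ≤ 1 + (γ * K) ^ 2 + γ * (β⁻¹ * (ε * (n * L ^ 2) -
        ∑ i, gibbsMean π h β x i ^ 2)) := fun x => by
    have h1 : ∑ i, gibbsMean π h β x i ^ 2 ≤ n * C ^ 2 := by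
      calc _ ≤ ∑ _i : Fin n, C ^ 2 := Finset.sum_le_sum fun i _ => by
            rw [← sq_abs]
            exact pow_le_pow_left₀ (abs_nonneg _) (abs_gibbsMean_le hm hβ hC x i) 2
        _ = _ := by simp
    have h2 : β⁻¹ * ∑ i, gibbsMean π h β x i ^ 2 ≤ K := by
      refine le_trans (mul_le_mul_of_nonneg_left (h1.trans ?_) (inv_pos.2 hβ).le) hK
      refine mul_le_mul_of_nonneg_left ?_ (Nat.cast_nonneg _)
      nlinarith [sq_nonneg C, sq_nonneg L]
    have h3 : 0 ≤ β⁻¹ * (ε * (n * L ^ 2)) := by positivity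
    nlinarith [mul_le_mul_of_nonneg_left h2 hγ.le, mul_nonneg hγ.le h3, sq_nonneg (γ * K)]
  have hlint : ∫⁻ p, ENNReal.ofReal (∫ lam, X p lam ∂π) ∂(Measure.pi fun _ : Fin n => μ) ≤
      ENNReal.ofReal (1 + (γ * K) ^ 2 + γ * (β⁻¹ * (ε * (n * L ^ 2) - J))) := by
    rw [← hinteq, ofReal_integral_eq_lintegral_ofReal hint (ae_of_all _ hnn)]
    refine le_trans (lintegral_mono fun p => ?_)
      (hμ.lintegral_increment_le (π := π) hm hβ hC hL hγ hε0 hε1 hK hγK)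
    rw [integral_eq_lintegral_of_nonneg_ae (ae_of_all _ (hXpos p))
      (hXm.comp measurable_prodMk_left).aestronglyMeasurable]
    exact ENNReal.ofReal_toReal_le
  -- Integrability of the exponential remainder is not known beforehand: it comes from the finite
  -- bound on its `lintegral`.
  have hXii : Integrable (fun p => ∫ lam, X p lam ∂π) (Measure.pi fun _ : Fin n => μ) := by
    refine ⟨hXim.aestronglyMeasurable, ?_⟩
    rw [hasFiniteIntegral_iff_ofReal (ae_of_all _ fun p => integral_nonneg (hXpos p))]
    exact hlint.trans_lt ENNReal.ofReal_lt_top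
  have hXle : ∫ p, ∫ lam, X p lam ∂π ∂(Measure.pi fun _ : Fin n => μ) ≤
      1 + (γ * K) ^ 2 + γ * (β⁻¹ * (ε * (n * L ^ 2) - J)) := by
    rw [integral_eq_lintegral_of_nonneg_ae (ae_of_all _ fun p => integral_nonneg (hXpos p))
      hXim.aestronglyMeasurable]
    refine ENNReal.toReal_le_of_le_ofReal ?_ hlint
    rw [← hinteq]
    exact integral_nonneg hnn
  have hl1 : Integrable (fun p : Fin n → ℝ × ℝ => logPartition π h β 1 (fun j => (p j).1))
      (Measure.pi fun _ => μ) := integrable_logPartition hm hβ hC 1 hfst hfi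
  have hl2 : Integrable (fun p : Fin n → ℝ × ℝ =>
      logPartition π h β (1 + γ) (fun j => (p j).1 + (p j).2)) (Measure.pi fun _ => μ) :=
    integrable_logPartition hm hβ hC _ hadd fun i => (hfi i).add (hsi i)
  have hl3 : Integrable (logPartition π h β 1) (Measure.pi fun _ => ν) :=
    integrable_logPartition hm hβ hC 1 measurable_id hxi
  have hl4 : Integrable (fun x : Fin n → ℝ => logPartition π h β (1 + γ) fun j => (1 + γ) * x j)
      (Measure.pi fun _ => ν) :=
    integrable_logPartition hm hβ hC _ hmul fun i => (hxi i).const_mul _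
  have hsum : Integrable (fun p : Fin n → ℝ × ℝ =>
      ∑ i, gibbsMean π h β (fun j => (p j).1) i * (p i).2) (Measure.pi fun _ => μ) :=
    integrable_finsetSum _ fun i _ => (hpi i).1
  have e1 : ∫ p : Fin n → ℝ × ℝ, logPartition π h β (1 + γ) (fun j => (p j).1 + (p j).2)
      ∂(Measure.pi fun _ => μ) = ∫ x : Fin n → ℝ, logPartition π h β (1 + γ)
        (fun j => (1 + γ) * x j) ∂(Measure.pi fun _ => ν) := by
    rw [← integral_map hadd.aemeasurable (hlm _).aestronglyMeasurable, hμ.map_add_pi,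
      integral_map hmul.aemeasurable (hlm _).aestronglyMeasurable]
  have e2 : ∫ p : Fin n → ℝ × ℝ, logPartition π h β 1 (fun j => (p j).1)
      ∂(Measure.pi fun _ => μ) = ∫ x, logPartition π h β 1 x ∂(Measure.pi fun _ => ν) := by
    rw [← integral_map hfst.aemeasurable (hlm _).aestronglyMeasurable, hμ.map_fst_pi]
  -- Scaling both `s` and `x` by `1 + γ` multiplies the potential by `1 + γ`.
  have e3 : (1 + γ) * ∫ x, logPartition π h β 1 x ∂(Measure.pi fun _ => ν) ≤
      ∫ x : Fin n → ℝ, logPartition π h β (1 + γ)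
        (fun j => (1 + γ) * x j) ∂(Measure.pi fun _ => ν) := by
    rw [← integral_const_mul]
    refine integral_mono (hl3.const_mul _) hl4 fun x => ?_
    have h1 := mul_log_integral_exp_le (π := π) (measurable_potential β 1 measurable_const hm)
      (fun lam => abs_potential_le hβ x (hC lam)) (s := 1 + γ) (by linarith)
    have h2 : ∀ w, potential β (1 + γ) (fun j => (1 + γ) * x j) w =
        (1 + γ) * potential β 1 x w := fun w => by
      have := potential_smul β 1 (1 + γ) x w
      rwa [mul_one] at this
    simp only [logPartition, h2]
    exact h1
  have hl5 : Integrable (fun p : Fin n → ℝ × ℝ => logPartition π h β 1 (fun j => (p j).1) +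
      2 * β⁻¹ * ∑ i, gibbsMean π h β (fun j => (p j).1) i * (p i).2) (Measure.pi fun _ => μ) :=
    hl1.add (hsum.const_mul _)
  have hl6 : Integrable (fun p : Fin n → ℝ × ℝ => logPartition π h β 1 (fun j => (p j).1) +
      2 * β⁻¹ * ∑ i, gibbsMean π h β (fun j => (p j).1) i * (p i).2 + ∫ lam, X p lam ∂π)
        (Measure.pi fun _ => μ) := hl5.add hXii
  have e4 := integral_mono hl2 (hl6.sub (integrable_const (1 : ℝ))) hb
  have e5 : ∫ p : Fin n → ℝ × ℝ, (logPartition π h β 1 (fun j => (p j).1) +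
      2 * β⁻¹ * ∑ i, gibbsMean π h β (fun j => (p j).1) i * (p i).2 + ∫ lam, X p lam ∂π - 1)
        ∂(Measure.pi fun _ => μ) = ∫ x, logPartition π h β 1 x ∂(Measure.pi fun _ => ν) +
          ∫ p, ∫ lam, X p lam ∂π ∂(Measure.pi fun _ : Fin n => μ) - 1 := by
    rw [integral_sub hl6 (integrable_const (1 : ℝ)),
      integral_add hl5 hXii, integral_add hl1 (hsum.const_mul _),
      integral_const_mul, integral_finsetSum _ fun i _ => (hpi i).1, e2]
    simp [(hpi _).2]
  have e6 := e4.trans_eq e5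
  linarith [e6, e3, e1]

/-- The expected squared norm of the Gibbs mean is at most minus `β` times the expected
log-partition function. -/
lemma AssumptionN.integral_gibbsMean_sq_le {t₀ : ℝ≥0∞} {v : ℝ → ℝ≥0} (hN : AssumptionN ν t₀ v)
    (hν : Integrable (fun x : ℝ => x) ν)
    (hm : Measurable h) (hβ : 0 < β) (hC : ∀ lam i, |h lam i| ≤ C)
    (hL : ∀ lam lam' i, |h lam i - h lam' i| ≤ L)
    (hβv : ∀ a, 4 * (v a : ℝ) ≤ β) (hβL : ENNReal.ofReal (2 * β⁻¹ * L) ≤ t₀) :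
    ∫ x, ∑ i, gibbsMean π h β x i ^ 2 ∂(Measure.pi fun _ : Fin n => ν) ≤
      -(β * ∫ x, logPartition π h β 1 x ∂(Measure.pi fun _ : Fin n => ν)) := by
  set J := ∫ x, ∑ i, gibbsMean π h β x i ^ 2 ∂(Measure.pi fun _ : Fin n => ν)
  set A := ∫ x, logPartition π h β 1 x ∂(Measure.pi fun _ : Fin n => ν)
  set K := β⁻¹ * (n * (3 * C ^ 2 + L ^ 2)) with hK
  have hK0 : 0 ≤ K := by positivity
  -- Choosing `γ (K + 1) < ε` ensures both `γ K ≤ 1` and `γ ≤ ε`, so a single parameter controls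
  -- every error term after division by `γ`.
  have key : ∀ ε : ℝ, 0 < ε → ε ≤ 1 → J ≤ -(β * A) + ε * (β * K ^ 2 + n * L ^ 2) := by
    intro ε hε hε1
    have h1 := hN.exists_isNoiseCoupling (T := 2 * β⁻¹ * L) (V := β / 4) hβL
      (fun a => by linarith [hβv a]) hε
    have h2 : ∀ᶠ γ : ℝ in 𝓝[>] 0, γ * (K + 1) < ε := by
      have : Tendsto (fun γ : ℝ => γ * (K + 1)) (𝓝[>] 0) (𝓝 (0 * (K + 1))) :=
        ((continuous_id.mul continuous_const).tendsto 0).mono_left nhdsWithin_le_nhds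
      rw [zero_mul] at this
      exact this.eventually_lt_const hε
    obtain ⟨γ, ⟨μ, hμ⟩, hγε, hγ⟩ := (h1.and (h2.and self_mem_nhdsWithin)).exists
    have hγ : 0 < γ := hγ
    have h3 := hμ.mul_integral_logPartition_le (π := π) hν hm hβ hC hL hγ hε.le hε1 le_rfl
      (by nlinarith)
    have h4 : γ * A ≤ γ * (γ * K ^ 2 + β⁻¹ * (ε * (n * L ^ 2) - J)) := by
      refine h3.trans_eq ?_
      ring
    have h5 : A ≤ γ * K ^ 2 + β⁻¹ * (ε * (n * L ^ 2) - J) := le_of_mul_le_mul_left h4 hγ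
    have h6 : β * A ≤ β * (γ * K ^ 2) + (ε * (n * L ^ 2) - J) := by
      have := mul_le_mul_of_nonneg_left h5 hβ.le
      rwa [mul_add, mul_inv_cancel_left₀ hβ.ne'] at this
    have h7 : γ ≤ ε := by nlinarith
    have h8 : β * (γ * K ^ 2) ≤ β * (ε * K ^ 2) := by gcongr
    linarith
  by_contra! hcon
  set Q := β * K ^ 2 + n * L ^ 2 with hQ
  have hQ0 : 0 ≤ Q := by positivity
  set d := J - -(β * A) with hd
  have hd0 : 0 < d := by linarith
  -- This choice makes the error at most `d / 2`, so the excess `d` would satisfy `d ≤ d / 2`.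
  have h1 := key (min 1 (d / (2 * (Q + 1)))) (by positivity) (min_le_left _ _)
  have h2 : min 1 (d / (2 * (Q + 1))) * Q ≤ d / (2 * (Q + 1)) * (Q + 1) := by
    refine mul_le_mul (min_le_right _ _) (by linarith) hQ0 (by positivity)
  have h3 : d / (2 * (Q + 1)) * (Q + 1) = d / 2 := by field_simp
  linarith

/-- PAC-Bayesian oracle inequality for a prior and a bounded family. -/
lemma AssumptionN.integral_gibbsMean_sq_le_of_le {t₀ : ℝ≥0∞} {v : ℝ → ℝ≥0}
    (hN : AssumptionN ν t₀ v)
    (hν : Integrable (fun x : ℝ => x) ν) (hν0 : ∫ x, x ∂ν = 0)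
    (hm : Measurable h) (hβ : 0 < β) (hC : ∀ lam i, |h lam i| ≤ C)
    (hL : ∀ lam lam' i, |h lam i - h lam' i| ≤ L)
    (hβv : ∀ a, 4 * (v a : ℝ) ≤ β) (hβL : ENNReal.ofReal (2 * β⁻¹ * L) ≤ t₀)
    {p : Measure Λ} [IsProbabilityMeasure p] {B : ℝ}
    (hp : p ≤ ENNReal.ofReal (Real.exp B) • π) :
    ∫ x, ∑ i, gibbsMean π h β x i ^ 2 ∂(Measure.pi fun _ : Fin n => ν) ≤
      ∫ lam, ∑ i, h lam i ^ 2 ∂p + β * B := by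
  refine (hN.integral_gibbsMean_sq_le (π := π) hν hm hβ hC hL hβv hβL).trans ?_
  have hxi : ∀ i, Integrable (fun x : Fin n → ℝ => x i) (Measure.pi fun _ => ν) := fun i =>
    (measurePreserving_eval (fun _ : Fin n => ν) i).integrable_comp_of_integrable hν
  have hx0 : ∀ i, ∫ x : Fin n → ℝ, x i ∂(Measure.pi fun _ => ν) = 0 := fun i => by
    have := integral_comp_eval (μ := fun _ : Fin n => ν) (i := i) (f := fun x : ℝ => x)
      measurable_id'.aestronglyMeasurable
    exact this.trans hν0
  have h1 : ∀ i, Integrable (fun lam => h lam i) p := fun i =>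
    integrable_of_abs_le (by fun_prop) fun lam => hC lam i
  have h2 : ∀ i, Integrable (fun lam => h lam i ^ 2) p := fun i =>
    integrable_of_abs_le (by fun_prop) (K := C ^ 2) fun lam => by
      rw [abs_pow]; exact pow_le_pow_left₀ (abs_nonneg _) (hC lam i) 2
  -- The lower bound is affine in the noise, so only its constant term survives the expectation.
  have hpt : ∀ x, -(β⁻¹ * ∑ i, (∫ lam, h lam i ^ 2 ∂p - 2 * (∫ lam, h lam i ∂p) * x i)) - B ≤
      logPartition π h β 1 x := fun x => by
    have := integral_sub_le_log_integral_exp (π := π) (measurable_potential β 1 measurable_const hm)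
      (fun lam => abs_potential_le hβ x (hC lam)) hp
    refine le_trans (le_of_eq ?_) this
    simp only [potential, one_mul]
    have h3 : ∀ i, Integrable (fun lam => h lam i ^ 2 - 2 * x i * h lam i) p := fun i =>
      (h2 i).sub ((h1 i).const_mul _)
    rw [integral_neg, integral_const_mul, integral_finsetSum _ fun i _ => h3 i]
    congr 4
    funext i
    rw [integral_sub (h2 i) ((h1 i).const_mul _), integral_const_mul]
    ring
  have hterm : ∀ i, Integrable (fun x : Fin n → ℝ =>
      ∫ lam, h lam i ^ 2 ∂p - 2 * (∫ lam, h lam i ∂p) * x i) (Measure.pi fun _ => ν) := fun i =>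
    (integrable_const _).sub ((hxi i).const_mul _)
  have hleft : Integrable (fun x : Fin n → ℝ =>
      -(β⁻¹ * ∑ i, (∫ lam, h lam i ^ 2 ∂p - 2 * (∫ lam, h lam i ∂p) * x i)))
        (Measure.pi fun _ => ν) :=
    ((integrable_finsetSum _ fun i _ => hterm i).const_mul _).neg
  have h3 := integral_mono (hleft.sub (integrable_const B))
    (integrable_logPartition hm hβ hC 1 measurable_id hxi) hpt
  simp only [Pi.sub_apply] at h3
  rw [integral_sub hleft (integrable_const B), integral_neg, integral_const_mul,
    integral_finsetSum _ fun i _ => hterm i] at h3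
  have h4 : ∀ i, ∫ x : Fin n → ℝ, (∫ lam, h lam i ^ 2 ∂p - 2 * (∫ lam, h lam i ∂p) * x i)
      ∂(Measure.pi fun _ => ν) = ∫ lam, h lam i ^ 2 ∂p := fun i => by
    rw [integral_sub (integrable_const _) ((hxi i).const_mul _), integral_const_mul, hx0]
    simp
  simp only [h4, integral_const, probReal_univ, one_smul, id] at h3
  rw [integral_finsetSum _ fun i _ => h2 i]
  have h5 := mul_le_mul_of_nonneg_left h3 hβ.le
  rw [mul_sub, mul_neg, mul_inv_cancel_left₀ hβ.ne'] at h5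
  linarith

end Oracle

/-! ### Products of measures with densities -/

/-- It is enough to compare on boxes, where the indicator of the box factorises along with the
density. -/
lemma pi_withDensity_ofReal {ι : Type*} [Fintype ι] {ρ : ℝ → ℝ} (hρ0 : ∀ u, 0 ≤ ρ u)
    (hρ : Integrable ρ) :
    (Measure.pi fun _ : ι => (volume : Measure ℝ).withDensity fun u => ENNReal.ofReal (ρ u)) =
      (volume : Measure (ι → ℝ)).withDensity fun u => ENNReal.ofReal (∏ j, ρ (u j)) := by
  have := isFiniteMeasure_withDensity_ofReal hρ.2
  refine Measure.pi_eq fun s hs => ?_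
  have hi : ∀ j, Integrable ((s j).indicator ρ) := fun j => hρ.indicator (hs j)
  have h0 : ∀ j u, 0 ≤ (s j).indicator ρ u := fun j u => Set.indicator_nonneg (fun u _ => hρ0 u) u
  have hprod : ∀ u : ι → ℝ, (Set.univ.pi s).indicator
      (fun u => ENNReal.ofReal (∏ j, ρ (u j))) u =
        ENNReal.ofReal (∏ j, (s j).indicator ρ (u j)) := fun u => by
    by_cases hu : u ∈ Set.univ.pi s
    · rw [Set.indicator_of_mem hu]
      congr 1
      exact Finset.prod_congr rfl fun j _ => (Set.indicator_of_mem (hu j (Set.mem_univ j)) _).symm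
    · rw [Set.indicator_of_notMem hu]
      obtain ⟨j, hj⟩ : ∃ j, u j ∉ s j := by
        by_contra! hcon; exact hu fun j _ => hcon j
      rw [Finset.prod_eq_zero (Finset.mem_univ j) (Set.indicator_of_notMem hj _),
        ENNReal.ofReal_zero]
  rw [withDensity_apply _ (MeasurableSet.univ_pi hs),
    ← lintegral_indicator (MeasurableSet.univ_pi hs)]
  simp only [hprod]
  have hip : Integrable (fun u : ι → ℝ => ∏ j, (s j).indicator ρ (u j)) :=
    Integrable.fintype_prod hi
  rw [← ofReal_integral_eq_lintegral_ofReal hip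
    (ae_of_all _ fun u => Finset.prod_nonneg fun j _ => h0 j _),
    integral_fintype_prod_volume_eq_prod (fun j => (s j).indicator ρ),
    ENNReal.ofReal_prod_of_nonneg fun j _ => integral_nonneg (h0 j)]
  refine Finset.prod_congr rfl fun j _ => ?_
  rw [withDensity_apply _ (hs j), ofReal_integral_eq_lintegral_ofReal (hi j) (ae_of_all _ (h0 j)),
    ← lintegral_indicator (hs j)]
  refine lintegral_congr fun u => ?_
  by_cases hu : u ∈ s j <;> simp [hu]

/-! ### A rescaled Student distribution -/

/-- The weight `(τ² + u²)⁻²`. -/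
def studentWeight (τ u : ℝ) : ℝ := 1 / (τ ^ 2 + u ^ 2) ^ 2

/-- The integral of `studentWeight`. -/
def studentMass (τ : ℝ) : ℝ := ∫ u, studentWeight τ u

/-- The probability measure with density proportional to `studentWeight`. -/
def studentMeasure (τ : ℝ) : Measure ℝ :=
  volume.withDensity fun u => ENNReal.ofReal (studentWeight τ u / studentMass τ)

section Student

variable {τ : ℝ}

lemma studentWeight_pos (hτ : 0 < τ) (u : ℝ) : 0 < studentWeight τ u := by
  unfold studentWeight; positivity

lemma continuous_studentWeight (hτ : 0 < τ) : Continuous (studentWeight τ) := by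
  unfold studentWeight
  exact continuous_const.div (by fun_prop) fun u => by positivity

lemma integrable_inv_sq_add_sq (hτ : 0 < τ) : Integrable fun u : ℝ => (τ ^ 2 + u ^ 2)⁻¹ := by
  have h := (integrable_inv_one_add_sq.comp_div hτ.ne').const_mul (τ ^ 2)⁻¹
  refine h.congr (ae_of_all _ fun u => ?_)
  simp only
  rw [← mul_inv, div_pow, mul_add, mul_one, mul_div_cancel₀ _ (by positivity)]

lemma integrable_sq_mul_studentWeight (hτ : 0 < τ) :
    Integrable fun u => u ^ 2 * studentWeight τ u := by
  refine (integrable_inv_sq_add_sq hτ).mono'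
    ((continuous_pow 2).mul (continuous_studentWeight hτ)).aestronglyMeasurable
    (ae_of_all _ fun u => ?_)
  rw [Real.norm_of_nonneg (mul_nonneg (sq_nonneg u) (studentWeight_pos hτ u).le), studentWeight,
    mul_one_div, div_le_iff₀ (by positivity), sq (τ ^ 2 + u ^ 2),
    inv_mul_cancel_left₀ (by positivity)]
  nlinarith [sq_nonneg τ]

lemma integrable_studentWeight (hτ : 0 < τ) : Integrable (studentWeight τ) := by
  refine ((integrable_inv_sq_add_sq hτ).const_mul (τ ^ 2)⁻¹).mono'
    (continuous_studentWeight hτ).aestronglyMeasurable (ae_of_all _ fun u => ?_)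
  rw [Real.norm_of_nonneg (studentWeight_pos hτ u).le, studentWeight, ← mul_inv, one_div]
  refine inv_anti₀ (by positivity) ?_
  rw [sq (τ ^ 2 + u ^ 2)]
  exact mul_le_mul_of_nonneg_right (by nlinarith [sq_nonneg u]) (by positivity)

lemma studentMass_pos (hτ : 0 < τ) : 0 < studentMass τ := by
  refine (integral_pos_iff_support_of_nonneg (fun u => (studentWeight_pos hτ u).le)
    (integrable_studentWeight hτ)).2 ?_
  have : Function.support (studentWeight τ) = Set.univ :=
    Set.eq_univ_of_forall fun u => (studentWeight_pos hτ u).ne'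
  simp [this]

/-- The function `u / (τ² + u²)` vanishes at both infinities and has derivative `(τ² - u²) / (τ² +
u²)²`. The second moment therefore follows without evaluating the normalising constant. -/
lemma integral_sq_mul_studentWeight (hτ : 0 < τ) :
    ∫ u, u ^ 2 * studentWeight τ u = τ ^ 2 * studentMass τ := by
  have hd : ∀ u : ℝ, HasDerivAt (fun u : ℝ => u * (τ ^ 2 + u ^ 2)⁻¹)
      (τ ^ 2 * studentWeight τ u - u ^ 2 * studentWeight τ u) u := fun u => by
    have h1 : HasDerivAt (fun u : ℝ => τ ^ 2 + u ^ 2) (2 * u) u := by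
      simpa using (hasDerivAt_pow 2 u).const_add (τ ^ 2)
    have h2 : τ ^ 2 + u ^ 2 ≠ 0 := by positivity
    refine ((hasDerivAt_id u).mul (h1.inv h2)).congr_deriv ?_
    simp only [id, studentWeight, Pi.inv_apply]
    field_simp
    ring
  have hsmall : Tendsto (fun u : ℝ => u⁻¹) (cocompact ℝ) (𝓝 0) := by
    rw [← Metric.cobounded_eq_cocompact]; exact tendsto_inv₀_cobounded
  have ht : Tendsto (fun u : ℝ => u * (τ ^ 2 + u ^ 2)⁻¹) (cocompact ℝ) (𝓝 0) := by
    refine squeeze_zero_norm (fun u => ?_) (tendsto_norm_zero.comp hsmall)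
    rw [Function.comp, norm_mul, norm_inv, norm_inv, Real.norm_of_nonneg
      (by positivity : 0 ≤ τ ^ 2 + u ^ 2)]
    rcases eq_or_ne u 0 with rfl | hu
    · simp
    · have hu' : 0 < ‖u‖ := norm_pos_iff.2 hu
      rw [← div_eq_mul_inv, div_le_iff₀ (by positivity), inv_mul_eq_div, le_div_iff₀ hu',
        ← sq, Real.norm_eq_abs, sq_abs]
      nlinarith [sq_nonneg τ]
  rw [cocompact_eq_atBot_atTop] at ht
  have h := integral_of_hasDerivAt_of_tendsto hd
    (((integrable_studentWeight hτ).const_mul _).sub (integrable_sq_mul_studentWeight hτ))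
    (ht.mono_left le_sup_left) (ht.mono_left le_sup_right)
  rw [integral_sub ((integrable_studentWeight hτ).const_mul _) (integrable_sq_mul_studentWeight hτ),
    integral_const_mul] at h
  rw [studentMass]
  linarith

lemma studentWeight_div_nonneg (hτ : 0 < τ) (u : ℝ) : 0 ≤ studentWeight τ u / studentMass τ :=
  (div_pos (studentWeight_pos hτ u) (studentMass_pos hτ)).le

lemma isProbabilityMeasure_studentMeasure (hτ : 0 < τ) :
    IsProbabilityMeasure (studentMeasure τ) := by
  constructor
  rw [studentMeasure, withDensity_apply _ MeasurableSet.univ, Measure.restrict_univ,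
    ← ofReal_integral_eq_lintegral_ofReal ((integrable_studentWeight hτ).div_const _)
      (ae_of_all _ (studentWeight_div_nonneg hτ)), integral_div, ← studentMass,
    div_self (studentMass_pos hτ).ne', ENNReal.ofReal_one]

lemma integrable_sq_studentMeasure (hτ : 0 < τ) :
    Integrable (fun u : ℝ => u ^ 2) (studentMeasure τ) := by
  rw [studentMeasure, integrable_withDensity_iff
    ((continuous_studentWeight hτ).div_const _).measurable.ennreal_ofReal
    (ae_of_all _ fun _ => ENNReal.ofReal_lt_top)]
  refine ((integrable_sq_mul_studentWeight hτ).div_const (studentMass τ)).congr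
    (ae_of_all _ fun u => ?_)
  simp only
  rw [ENNReal.toReal_ofReal (studentWeight_div_nonneg hτ u)]
  ring

lemma integral_sq_studentMeasure (hτ : 0 < τ) : ∫ u, u ^ 2 ∂(studentMeasure τ) = τ ^ 2 := by
  rw [studentMeasure, integral_withDensity_eq_integral_toReal_smul
    ((continuous_studentWeight hτ).div_const _).measurable.ennreal_ofReal
    (ae_of_all _ fun _ => ENNReal.ofReal_lt_top)]
  have h : ∀ u, (ENNReal.ofReal (studentWeight τ u / studentMass τ)).toReal • u ^ 2 =
      u ^ 2 * studentWeight τ u / studentMass τ := fun u => by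
    rw [ENNReal.toReal_ofReal (studentWeight_div_nonneg hτ u), smul_eq_mul]; ring
  simp only [h]
  rw [integral_div, integral_sq_mul_studentWeight hτ, mul_div_cancel_right₀ _ (studentMass_pos hτ).ne']

/-- From `2τ|u| ≤ u² + τ²` and the second moment `τ²`. -/
lemma integrable_abs_studentMeasure (hτ : 0 < τ) :
    Integrable (fun u : ℝ => |u|) (studentMeasure τ) ∧ ∫ u, |u| ∂(studentMeasure τ) ≤ τ := by
  have := isProbabilityMeasure_studentMeasure hτ
  have hle : ∀ u : ℝ, |u| ≤ (2 * τ)⁻¹ * (u ^ 2 + τ ^ 2) := fun u => by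
    rw [inv_mul_eq_div, le_div_iff₀ (by positivity)]
    nlinarith [sq_nonneg (|u| - τ), sq_abs u]
  have hint : Integrable (fun u : ℝ => (2 * τ)⁻¹ * (u ^ 2 + τ ^ 2)) (studentMeasure τ) :=
    ((integrable_sq_studentMeasure hτ).add (integrable_const _)).const_mul _
  have h1 : Integrable (fun u : ℝ => |u|) (studentMeasure τ) :=
    hint.mono' continuous_abs.aestronglyMeasurable (ae_of_all _ fun u => by
      rw [Real.norm_eq_abs, abs_abs]; exact hle u)
  refine ⟨h1, (integral_mono h1 hint hle).trans_eq ?_⟩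
  rw [integral_const_mul, integral_add (integrable_sq_studentMeasure hτ) (integrable_const _),
    integral_sq_studentMeasure hτ]
  simp
  field_simp
  ring

lemma measurePreserving_neg_studentMeasure (τ : ℝ) :
    MeasurePreserving (fun u : ℝ => -u) (studentMeasure τ) (studentMeasure τ) := by
  refine ⟨measurable_neg, Measure.ext fun s hs => ?_⟩
  rw [Measure.map_apply measurable_neg hs, studentMeasure,
    withDensity_apply _ (measurable_neg hs), withDensity_apply _ hs,
    ← lintegral_indicator (measurable_neg hs), ← lintegral_indicator hs,
    ← lintegral_neg_eq_self]
  refine lintegral_congr fun u => ?_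
  have h : -u ∈ Neg.neg ⁻¹' s ↔ u ∈ s := by simp
  by_cases hu : u ∈ s
  · rw [Set.indicator_of_mem hu, Set.indicator_of_mem (h.2 hu)]
    simp only [studentWeight, neg_sq]
  · rw [Set.indicator_of_notMem hu, Set.indicator_of_notMem (fun hc => hu (h.1 hc))]

end Student

/-! ### The product of Student distributions, conditioned on an `ℓ¹` ball -/

lemma continuous_l1Norm (M : ℕ) : Continuous (l1Norm (M := M)) := by
  unfold l1Norm; fun_prop

lemma l1Norm_nonneg {M : ℕ} (u : Fin M → ℝ) : 0 ≤ l1Norm u :=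
  Finset.sum_nonneg fun _ _ => abs_nonneg _

lemma l1Norm_add_le {M : ℕ} (u w : Fin M → ℝ) : l1Norm (u + w) ≤ l1Norm u + l1Norm w := by
  simp only [l1Norm, ← Finset.sum_add_distrib]
  exact Finset.sum_le_sum fun j _ => abs_add_le _ _

lemma abs_le_l1Norm {M : ℕ} (u : Fin M → ℝ) (j : Fin M) : |u j| ≤ l1Norm u :=
  Finset.single_le_sum (f := fun j => |u j|) (fun _ _ => abs_nonneg _) (Finset.mem_univ j)

/-- The set on which the `ℓ¹` norm is at most `2Mτ`. -/
def localBall (M : ℕ) (τ : ℝ) : Set (Fin M → ℝ) := {u | l1Norm u ≤ 2 * M * τ}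

lemma measurableSet_localBall (M : ℕ) (τ : ℝ) : MeasurableSet (localBall M τ) :=
  (isClosed_le (continuous_l1Norm M) continuous_const).measurableSet

/-- The product of Student distributions conditioned on `localBall`. -/
def localMeasure (M : ℕ) (τ : ℝ) : Measure (Fin M → ℝ) :=
  ((Measure.pi fun _ => studentMeasure τ) (localBall M τ))⁻¹ •
    (Measure.pi fun _ => studentMeasure τ).restrict (localBall M τ)

section Local

variable {M : ℕ} {τ : ℝ}

/-- Markov's inequality: the expected `ℓ¹` norm is at most `Mτ`, half the radius. -/
lemma half_le_pi_studentMeasure_localBall (hM : 0 < M) (hτ : 0 < τ) :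
    2⁻¹ ≤ (Measure.pi fun _ : Fin M => studentMeasure τ) (localBall M τ) := by
  have := isProbabilityMeasure_studentMeasure hτ
  set μ := Measure.pi fun _ : Fin M => studentMeasure τ with hμ
  have hM' : (0 : ℝ) < M := by exact_mod_cast hM
  have habs := integrable_abs_studentMeasure hτ
  have hi : ∀ j, Integrable (fun u : Fin M → ℝ => |u j|) μ := fun j =>
    (measurePreserving_eval (fun _ : Fin M => studentMeasure τ) j).integrable_comp_of_integrable
      habs.1
  have hint : Integrable (l1Norm (M := M)) μ := integrable_finsetSum _ fun j _ => hi j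
  have hle : ∫ u, l1Norm u ∂μ ≤ M * τ := by
    simp only [l1Norm]
    rw [integral_finsetSum _ fun j _ => hi j]
    calc _ ≤ ∑ _j : Fin M, τ := Finset.sum_le_sum fun j _ => by
          rw [hμ, integral_comp_eval (μ := fun _ : Fin M => studentMeasure τ)
            (f := fun u : ℝ => |u|) continuous_abs.aestronglyMeasurable]
          exact habs.2
      _ = _ := by simp
  have hmarkov := mul_meas_ge_le_integral_of_nonneg (μ := μ) (ae_of_all _ l1Norm_nonneg) hint
    (2 * M * τ)
  have h1 : μ.real {u | 2 * M * τ ≤ l1Norm u} ≤ 1 / 2 := by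
    have : (2 * M * τ) * μ.real {u | 2 * M * τ ≤ l1Norm u} ≤ (2 * M * τ) * (1 / 2) := by
      refine (hmarkov.trans hle).trans_eq (by ring)
    exact le_of_mul_le_mul_left this (by positivity)
  have h2 : μ.real (localBall M τ)ᶜ ≤ 1 / 2 := by
    refine (measureReal_mono fun u hu => ?_).trans h1
    exact (not_le.1 fun h : l1Norm u ≤ 2 * M * τ => hu h).le
  rw [measureReal_compl (measurableSet_localBall M τ), probReal_univ] at h2
  have h3 : (2 : ℝ)⁻¹ ≤ μ.real (localBall M τ) := by linarith
  rw [Measure.real, ← ENNReal.ofReal_le_iff_le_toReal (measure_ne_top _ _)] at h3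
  refine le_trans (le_of_eq ?_) h3
  rw [ENNReal.ofReal_inv_of_pos (by norm_num)]
  simp

lemma pi_studentMeasure_localBall_ne_zero (hM : 0 < M) (hτ : 0 < τ) :
    (Measure.pi fun _ : Fin M => studentMeasure τ) (localBall M τ) ≠ 0 := fun h0 => by
  have := half_le_pi_studentMeasure_localBall hM hτ
  rw [h0] at this
  simp at this

lemma inv_pi_studentMeasure_localBall_le (hM : 0 < M) (hτ : 0 < τ) :
    ((Measure.pi fun _ : Fin M => studentMeasure τ) (localBall M τ))⁻¹ ≤ 2 := by
  rw [ENNReal.inv_le_iff_inv_le]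
  exact half_le_pi_studentMeasure_localBall hM hτ

lemma isProbabilityMeasure_localMeasure (hM : 0 < M) (hτ : 0 < τ) :
    IsProbabilityMeasure (localMeasure M τ) := by
  have := isProbabilityMeasure_studentMeasure hτ
  constructor
  rw [localMeasure, Measure.smul_apply, Measure.restrict_apply_univ, smul_eq_mul,
    ENNReal.inv_mul_cancel (pi_studentMeasure_localBall_ne_zero hM hτ) (measure_ne_top _ _)]

lemma ae_localMeasure_mem (M : ℕ) (τ : ℝ) : ∀ᵐ u ∂(localMeasure M τ), u ∈ localBall M τ :=
  Measure.ae_smul_measure (ae_restrict_mem (measurableSet_localBall M τ)) _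

/-- The reflection in the `j`-th coordinate hyperplane. -/
def reflect (j : Fin M) (u : Fin M → ℝ) (k : Fin M) : ℝ := if k = j then -u k else u k

lemma measurePreserving_reflect (hτ : 0 < τ) (j : Fin M) :
    MeasurePreserving (reflect j) (localMeasure M τ) (localMeasure M τ) := by
  have := isProbabilityMeasure_studentMeasure hτ
  have h1 : MeasurePreserving (reflect j) (Measure.pi fun _ : Fin M => studentMeasure τ)
      (Measure.pi fun _ => studentMeasure τ) := by
    refine measurePreserving_pi (fun _ : Fin M => studentMeasure τ) (fun _ => studentMeasure τ)
      (f := fun k t => if k = j then -t else t) fun k => ?_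
    by_cases hk : k = j
    · simpa [hk] using measurePreserving_neg_studentMeasure τ
    · simp only [hk, if_false]
      exact MeasurePreserving.id (studentMeasure τ)
  have h2 := h1.restrict_preimage (measurableSet_localBall M τ)
  have h3 : reflect j ⁻¹' localBall M τ = localBall M τ := by
    ext u
    simp only [localBall, Set.mem_preimage, Set.mem_ofPred_eq, l1Norm]
    have : ∀ k, |reflect j u k| = |u k| := fun k => by
      unfold reflect; split_ifs <;> simp
    simp [this]
  rw [h3] at h2
  exact h2.smul_measure _

lemma integrable_mul_localMeasure (hM : 0 < M) (hτ : 0 < τ) (j k : Fin M) :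
    Integrable (fun u : Fin M → ℝ => u j * u k) (localMeasure M τ) := by
  have := isProbabilityMeasure_localMeasure hM hτ
  refine Integrable.of_bound (C := (2 * M * τ) * (2 * M * τ)) (by fun_prop) ?_
  filter_upwards [ae_localMeasure_mem M τ] with u hu
  rw [norm_mul]
  exact mul_le_mul ((abs_le_l1Norm u j).trans hu) ((abs_le_l1Norm u k).trans hu)
    (norm_nonneg _) (by positivity)

lemma integrable_apply_localMeasure (hM : 0 < M) (hτ : 0 < τ) (j : Fin M) :
    Integrable (fun u : Fin M → ℝ => u j) (localMeasure M τ) := by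
  have := isProbabilityMeasure_localMeasure hM hτ
  refine Integrable.of_bound (C := 2 * M * τ) (measurable_pi_apply j).aestronglyMeasurable ?_
  filter_upwards [ae_localMeasure_mem M τ] with u hu
  exact (abs_le_l1Norm u j).trans hu

/-- Reflecting the `j`-th coordinate preserves both the product law and the `ℓ¹` ball. The same
symmetry makes distinct coordinates uncorrelated. -/
lemma integral_apply_localMeasure (hτ : 0 < τ) (j : Fin M) :
    ∫ u : Fin M → ℝ, u j ∂(localMeasure M τ) = 0 := by
  have hmp := measurePreserving_reflect hτ j
  have h1 : ∫ u : Fin M → ℝ, u j ∂(localMeasure M τ) =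
      ∫ u : Fin M → ℝ, reflect j u j ∂(localMeasure M τ) := by
    conv_lhs => rw [← hmp.map_eq]
    exact integral_map hmp.measurable.aemeasurable (measurable_pi_apply j).aestronglyMeasurable
  simp only [reflect, if_true, integral_neg] at h1
  linarith

lemma integral_mul_localMeasure (hτ : 0 < τ) {j k : Fin M} (hjk : j ≠ k) :
    ∫ u : Fin M → ℝ, u j * u k ∂(localMeasure M τ) = 0 := by
  have hmp := measurePreserving_reflect hτ j
  have h1 : ∫ u : Fin M → ℝ, u j * u k ∂(localMeasure M τ) =
      ∫ u : Fin M → ℝ, reflect j u j * reflect j u k ∂(localMeasure M τ) := by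
    conv_lhs => rw [← hmp.map_eq]
    exact integral_map hmp.measurable.aemeasurable (by fun_prop)
  simp only [reflect, if_true, if_neg hjk.symm, neg_mul, integral_neg] at h1
  linarith

/-- The unconditioned variance is `τ²`; conditioning on an event of probability at least `1/2` costs
at most a factor `2`. -/
lemma integral_sq_localMeasure_le (hM : 0 < M) (hτ : 0 < τ) (j : Fin M) :
    ∫ u : Fin M → ℝ, u j * u j ∂(localMeasure M τ) ≤ 2 * τ ^ 2 := by
  have := isProbabilityMeasure_studentMeasure hτ
  have hi : Integrable (fun u : Fin M → ℝ => u j ^ 2) (Measure.pi fun _ => studentMeasure τ) :=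
    (measurePreserving_eval (fun _ : Fin M => studentMeasure τ) j).integrable_comp_of_integrable
      (integrable_sq_studentMeasure hτ)
  have h1 : ∫ u in localBall M τ, u j ^ 2 ∂(Measure.pi fun _ => studentMeasure τ) ≤ τ ^ 2 := by
    refine (setIntegral_le_integral hi (ae_of_all _ fun u => sq_nonneg _)).trans_eq ?_
    rw [integral_comp_eval (μ := fun _ : Fin M => studentMeasure τ)
      (f := fun u : ℝ => u ^ 2) (continuous_pow 2).aestronglyMeasurable,
      integral_sq_studentMeasure hτ]
  have h2 : (((Measure.pi fun _ : Fin M => studentMeasure τ) (localBall M τ))⁻¹).toReal ≤ 2 :=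
    ENNReal.toReal_le_of_le_ofReal (by norm_num)
      (by simpa using inv_pi_studentMeasure_localBall_le hM hτ)
  simp only [← sq]
  rw [localMeasure, integral_smul_measure, smul_eq_mul]
  exact mul_le_mul h2 h1 (integral_nonneg fun u => sq_nonneg _) (by norm_num)

/-- The linear functional with coefficients `c` is centred under `localMeasure`. -/
lemma integral_linear_localMeasure (hM : 0 < M) (hτ : 0 < τ) (c : Fin M → ℝ) :
    ∫ u : Fin M → ℝ, ∑ j, u j * c j ∂(localMeasure M τ) = 0 := by
  rw [integral_finsetSum _ fun j _ => (integrable_apply_localMeasure hM hτ j).mul_const _]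
  refine Finset.sum_eq_zero fun j _ => ?_
  rw [integral_mul_const, integral_apply_localMeasure hτ, zero_mul]

lemma integral_linear_sq_localMeasure_le (hM : 0 < M) (hτ : 0 < τ) (c : Fin M → ℝ) :
    ∫ u : Fin M → ℝ, (∑ j, u j * c j) ^ 2 ∂(localMeasure M τ) ≤ 2 * τ ^ 2 * ∑ j, c j ^ 2 := by
  have h1 : ∀ u : Fin M → ℝ, (∑ j, u j * c j) ^ 2 = ∑ j, ∑ k, c j * c k * (u j * u k) := fun u => by
    rw [sq, Finset.sum_mul_sum]
    exact Finset.sum_congr rfl fun j _ => Finset.sum_congr rfl fun k _ => by ring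
  simp only [h1]
  have hi := fun j k : Fin M => (integrable_mul_localMeasure hM hτ j k).const_mul (c j * c k)
  rw [integral_finsetSum _ fun j _ => integrable_finsetSum _ fun k _ => hi j k, Finset.mul_sum]
  refine Finset.sum_le_sum fun j _ => ?_
  rw [integral_finsetSum _ fun k _ => hi j k, Finset.sum_eq_single j]
  · rw [integral_const_mul]
    nlinarith [mul_le_mul_of_nonneg_left (integral_sq_localMeasure_le hM hτ j) (sq_nonneg (c j))]
  · intro k _ hk
    rw [integral_const_mul, integral_mul_localMeasure hτ hk.symm, mul_zero]
  · simp

end Local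

/-! ### The sparsity prior -/

lemma huber_nonneg (t : ℝ) : 0 ≤ huber t := by
  unfold huber
  split_ifs with h
  · exact sq_nonneg t
  · linarith [not_le.1 h]

lemma huber_le (t : ℝ) : huber t ≤ 2 * |t| := by
  unfold huber
  split_ifs with h
  · nlinarith [abs_nonneg t, sq_abs t]
  · linarith

lemma measurable_huber : Measurable huber := by
  unfold huber
  exact Measurable.ite (measurableSet_le measurable_id.abs measurable_const) (by fun_prop)
    (by fun_prop)

lemma isClosed_l1Ball (M : ℕ) (R : ℝ≥0∞) : IsClosed (l1Ball M R) :=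
  isClosed_le (ENNReal.continuous_ofReal.comp (continuous_l1Norm M)) continuous_const

section Prior

variable {M : ℕ} {α τ : ℝ} {R : ℝ≥0∞}

lemma sparsityWeight_eq (lam : Fin M → ℝ) (h : lam ∈ l1Ball M R) :
    sparsityWeight M α τ R lam =
      τ ^ (2 * M) * ∏ j, Real.exp (-huber (α * lam j)) * studentWeight τ (lam j) := by
  rw [sparsityWeight, Set.indicator_of_mem h]
  simp only [studentWeight, mul_one_div]

lemma sparsityWeight_nonneg (hτ : 0 < τ) (lam : Fin M → ℝ) : 0 ≤ sparsityWeight M α τ R lam := by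
  refine Set.indicator_nonneg (fun lam _ => ?_) lam
  positivity

lemma measurable_sparsityWeight : Measurable (sparsityWeight M α τ R) := by
  refine Measurable.indicator ?_ (isClosed_l1Ball M R).measurableSet
  have h := measurable_huber
  fun_prop

lemma sparsityWeight_le (hτ : 0 < τ) (lam : Fin M → ℝ) :
    sparsityWeight M α τ R lam ≤ τ ^ (2 * M) * ∏ j, studentWeight τ (lam j) := by
  have h0 : 0 ≤ τ ^ (2 * M) * ∏ j, studentWeight τ (lam j) :=
    mul_nonneg (by positivity) (Finset.prod_nonneg fun j _ => (studentWeight_pos hτ _).le)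
  by_cases h : lam ∈ l1Ball M R
  · rw [sparsityWeight_eq lam h]
    refine mul_le_mul_of_nonneg_left (Finset.prod_le_prod (fun j _ =>
      mul_nonneg (Real.exp_pos _).le (studentWeight_pos hτ _).le) fun j _ => ?_) (by positivity)
    refine mul_le_of_le_one_left (studentWeight_pos hτ _).le (Real.exp_le_one_iff.2 ?_)
    linarith [huber_nonneg (α * lam j)]
  · rwa [sparsityWeight, Set.indicator_of_notMem h]

lemma integrable_prod_studentWeight (M : ℕ) (hτ : 0 < τ) :
    Integrable fun lam : Fin M → ℝ => τ ^ (2 * M) * ∏ j, studentWeight τ (lam j) :=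
  (Integrable.fintype_prod fun _ : Fin M => integrable_studentWeight hτ).const_mul _

lemma integrable_sparsityWeight (hτ : 0 < τ) : Integrable (sparsityWeight M α τ R) :=
  (integrable_prod_studentWeight M hτ).mono' measurable_sparsityWeight.aestronglyMeasurable
    (ae_of_all _ fun lam => by
      rw [Real.norm_of_nonneg (sparsityWeight_nonneg hτ lam)]; exact sparsityWeight_le hτ lam)

lemma lintegral_sparsityWeight_le (hτ : 0 < τ) :
    ∫⁻ lam, ENNReal.ofReal (sparsityWeight M α τ R lam) ≤
      ENNReal.ofReal (τ ^ (2 * M) * studentMass τ ^ M) := by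
  refine (lintegral_mono fun lam => ENNReal.ofReal_le_ofReal (sparsityWeight_le hτ lam)).trans ?_
  rw [← ofReal_integral_eq_lintegral_ofReal (integrable_prod_studentWeight M hτ)
    (ae_of_all _ fun lam => mul_nonneg (by positivity)
      (Finset.prod_nonneg fun j _ => (studentWeight_pos hτ _).le)), integral_const_mul,
    integral_fintype_prod_volume_eq_prod fun _ => studentWeight τ]
  simp [studentMass]

lemma add_mem_l1Ball (hR : ENNReal.ofReal (2 * M * τ) < R) {s : Fin M → ℝ}
    (hs : ENNReal.ofReal (l1Norm s) ≤ R - ENNReal.ofReal (2 * M * τ)) {u : Fin M → ℝ}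
    (hu : u ∈ localBall M τ) : s + u ∈ l1Ball M R := by
  have hu' : l1Norm u ≤ 2 * M * τ := hu
  calc ENNReal.ofReal (l1Norm (s + u))
      ≤ ENNReal.ofReal (l1Norm s + 2 * M * τ) :=
        ENNReal.ofReal_le_ofReal ((l1Norm_add_le s u).trans (by linarith))
    _ ≤ ENNReal.ofReal (l1Norm s) + ENNReal.ofReal (2 * M * τ) := ENNReal.ofReal_add_le
    _ ≤ R - ENNReal.ofReal (2 * M * τ) + ENNReal.ofReal (2 * M * τ) := by gcongr
    _ = R := tsub_add_cancel_of_le hR.le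

/-- Polynomial tails make translation cheap. With `a = |s|/τ`, the inequality `2aτ|u| ≤ a(τ² + u²)`
gives `τ² + (s+u)² ≤ (1+a)²(τ² + u²)`; squaring produces the factor `4` in front of the logarithm.
-/
lemma studentWeight_le_mul (hτ : 0 < τ) (s u : ℝ) :
    studentWeight τ u ≤ Real.exp (4 * Real.log (1 + |s| / τ)) * studentWeight τ (s + u) := by
  have hs : 0 < 1 + |s| / τ := by positivity
  have h1 : Real.exp (4 * Real.log (1 + |s| / τ)) = ((1 + |s| / τ) ^ 2) ^ 2 := by
    rw [mul_comm, Real.exp_mul, Real.exp_log hs, ← pow_mul]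
    norm_cast
  have h2 : τ ^ 2 + (s + u) ^ 2 ≤ (1 + |s| / τ) ^ 2 * (τ ^ 2 + u ^ 2) := by
    set a := |s| / τ with ha
    have ha0 : 0 ≤ a := by positivity
    have has : |s| = a * τ := by rw [ha]; field_simp
    have h3 : s ^ 2 = a ^ 2 * τ ^ 2 := by rw [← sq_abs, has]; ring
    have h4 : s * u ≤ a * τ * |u| := by
      rw [← has, ← abs_mul]; exact le_abs_self _
    have h5 := mul_nonneg ha0 (sq_nonneg (τ - |u|))
    nlinarith [sq_abs u, mul_nonneg ha0 (sq_nonneg u), sq_nonneg (a * u),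
      mul_nonneg ha0 (sq_nonneg τ)]
  rw [h1, studentWeight, studentWeight, mul_one_div, div_le_div_iff₀ (by positivity)
    (by positivity), one_mul, ← mul_pow]
  exact pow_le_pow_left₀ (by positivity) h2 2

lemma prod_studentWeight_le (hτ : 0 < τ) (hα : 0 < α) (hM : 0 < M) (hατ : α ≤ 1 / (4 * M * τ))
    (hR : ENNReal.ofReal (2 * M * τ) < R) {s : Fin M → ℝ}
    (hs : ENNReal.ofReal (l1Norm s) ≤ R - ENNReal.ofReal (2 * M * τ)) {u : Fin M → ℝ}
    (hu : u ∈ localBall M τ) :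
    τ ^ (2 * M) * ∏ j, studentWeight τ (u j) ≤
      Real.exp (4 * ∑ j, Real.log (1 + |s j| / τ) + (2 * (α * l1Norm s) + 1)) *
        sparsityWeight M α τ R (s + u) := by
  have hM' : (0 : ℝ) < M := by exact_mod_cast hM
  have hu' : l1Norm u ≤ 2 * M * τ := hu
  rw [sparsityWeight_eq _ (add_mem_l1Ball hR hs hu), mul_left_comm]
  refine mul_le_mul_of_nonneg_left ?_ (by positivity)
  have h1 : Real.exp (∑ j, huber (α * (s + u) j)) ≤ Real.exp (2 * (α * l1Norm s) + 1) := by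
    refine Real.exp_le_exp.2 ?_
    calc ∑ j, huber (α * (s + u) j) ≤ ∑ j, 2 * α * |(s + u) j| := Finset.sum_le_sum fun j _ => by
          refine (huber_le _).trans_eq ?_
          rw [abs_mul, abs_of_pos hα, mul_assoc]
      _ = 2 * α * l1Norm (s + u) := by rw [← Finset.mul_sum, l1Norm]
      _ ≤ 2 * α * (l1Norm s + 2 * M * τ) := by
          refine mul_le_mul_of_nonneg_left ?_ (by positivity)
          linarith [l1Norm_add_le s u]
      -- The restriction on `α` says exactly that the perturbation costs `2α · 2Mτ ≤ 1`.
      _ ≤ 2 * (α * l1Norm s) + 1 := by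
          rw [le_div_iff₀ (by positivity)] at hατ
          linarith
  have hpos : 0 < ∏ j, studentWeight τ (u j) := Finset.prod_pos fun j _ => studentWeight_pos hτ _
  calc ∏ j, studentWeight τ (u j)
      ≤ ∏ j, (Real.exp (4 * Real.log (1 + |s j| / τ)) * studentWeight τ ((s + u) j)) :=
        Finset.prod_le_prod (fun j _ => (studentWeight_pos hτ _).le)
          fun j _ => studentWeight_le_mul hτ (s j) (u j)
    _ = Real.exp (4 * ∑ j, Real.log (1 + |s j| / τ)) *
          (Real.exp (∑ j, huber (α * (s + u) j)) *
            ∏ j, Real.exp (-huber (α * (s + u) j)) * studentWeight τ ((s + u) j)) := by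
        rw [Finset.prod_mul_distrib, Finset.prod_mul_distrib, ← Real.exp_sum, ← Real.exp_sum,
          Finset.mul_sum, ← mul_assoc (Real.exp (∑ j, huber _)), ← Real.exp_add,
          Finset.sum_neg_distrib, add_neg_cancel, Real.exp_zero, one_mul]
    _ ≤ _ := by
        rw [Real.exp_add, mul_assoc]
        refine mul_le_mul_of_nonneg_left (mul_le_mul_of_nonneg_right h1 ?_) (Real.exp_pos _).le
        exact Finset.prod_nonneg fun j _ =>
          mul_nonneg (Real.exp_pos _).le (studentWeight_pos hτ _).le

/-- The translate of `localMeasure` is dominated by a multiple of the sparsity prior. -/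
lemma map_localMeasure_le (hτ : 0 < τ) (hα : 0 < α) (hM : 0 < M) (hατ : α ≤ 1 / (4 * M * τ))
    (hR : ENNReal.ofReal (2 * M * τ) < R) {s : Fin M → ℝ}
    (hs : ENNReal.ofReal (l1Norm s) ≤ R - ENNReal.ofReal (2 * M * τ)) :
    (localMeasure M τ).map (fun u => s + u) ≤
      ENNReal.ofReal (Real.exp (4 * ∑ j, Real.log (1 + |s j| / τ) + 2 * (α * l1Norm s + 1))) •
        sparsityPrior M α τ R := by
  have hshift : Measurable fun u : Fin M → ℝ => s + u := measurable_const_add s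
  have hm := studentMass_pos hτ
  set c := Real.exp (4 * ∑ j, Real.log (1 + |s j| / τ) + (2 * (α * l1Norm s) + 1)) with hc
  have hc0 : 0 < c := Real.exp_pos _
  -- `D` is the mass the prior weight would have without the Huber factors and the ball constraint.
  -- It bounds the true normaliser from above, so its inverse bounds the prior density from below.
  set D := τ ^ (2 * M) * studentMass τ ^ M with hD
  have hD0 : 0 < D := by positivity
  have hwm := (measurable_sparsityWeight (M := M) (α := α) (τ := τ) (R := R)).ennreal_ofReal
  refine Measure.le_iff.2 fun A hA => ?_
  have hSm : MeasurableSet ((fun u : Fin M → ℝ => s + u) ⁻¹' A ∩ localBall M τ) :=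
    (hshift hA).inter (measurableSet_localBall M τ)
  have key : (Measure.pi fun _ : Fin M => studentMeasure τ)
      ((fun u : Fin M → ℝ => s + u) ⁻¹' A ∩ localBall M τ) ≤
        ENNReal.ofReal c * ((ENNReal.ofReal D)⁻¹ *
          ∫⁻ lam in A, ENNReal.ofReal (sparsityWeight M α τ R lam)) := by
    unfold studentMeasure
    rw [pi_withDensity_ofReal (studentWeight_div_nonneg hτ)
      ((integrable_studentWeight hτ).div_const _), withDensity_apply _ hSm,
      ← ENNReal.ofReal_inv_of_pos hD0, ← lintegral_const_mul _ hwm, ← lintegral_const_mul _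
        (hwm.const_mul _), ← lintegral_indicator hSm, ← lintegral_indicator hA]
    -- The densities are compared at the translated point, and Lebesgue measure is translation
    -- invariant.
    refine le_trans (lintegral_mono fun u => ?_) (lintegral_add_left_eq_self _ s).le
    refine Set.indicator_apply_le' (fun hu => ?_) fun _ => zero_le
    rw [Set.indicator_of_mem (Set.mem_preimage.1 hu.1), ← ENNReal.ofReal_mul (by positivity),
      ← ENNReal.ofReal_mul (by positivity)]
    refine ENNReal.ofReal_le_ofReal ?_
    have h1 := prod_studentWeight_le hτ hα hM hατ hR hs hu.2
    rw [Finset.prod_div_distrib, Finset.prod_const, Finset.card_univ, Fintype.card_fin,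
      div_le_iff₀ (by positivity)]
    have h2 : c * (D⁻¹ * sparsityWeight M α τ R (s + u)) * studentMass τ ^ M =
        (c * sparsityWeight M α τ R (s + u)) / τ ^ (2 * M) := by
      rw [hD]; field_simp
    rw [h2, le_div_iff₀ (by positivity), mul_comm]
    exact h1
  rw [Measure.map_apply hshift hA, localMeasure, Measure.smul_apply, smul_eq_mul,
    Measure.restrict_apply (hshift hA), Measure.smul_apply, smul_eq_mul, sparsityPrior,
    Measure.smul_apply, smul_eq_mul, withDensity_apply _ hA]
  -- The factor `2` from conditioning is absorbed by `2 ≤ e`: the second unit in the `2` of `2 * (α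
  -- * l1Norm s + 1)`.
  have h2c : 2 * ENNReal.ofReal c ≤ ENNReal.ofReal
      (Real.exp (4 * ∑ j, Real.log (1 + |s j| / τ) + 2 * (α * l1Norm s + 1))) := by
    have : (4 * ∑ j, Real.log (1 + |s j| / τ) + 2 * (α * l1Norm s + 1)) =
        1 + (4 * ∑ j, Real.log (1 + |s j| / τ) + (2 * (α * l1Norm s) + 1)) := by ring
    rw [this, Real.exp_add, ENNReal.ofReal_mul (Real.exp_pos _).le]
    gcongr
    rw [show (2 : ℝ≥0∞) = ENNReal.ofReal 2 by simp]
    exact ENNReal.ofReal_le_ofReal (by linarith [Real.add_one_le_exp (1 : ℝ)])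
  calc _ ≤ 2 * (ENNReal.ofReal c * ((ENNReal.ofReal D)⁻¹ *
          ∫⁻ lam in A, ENNReal.ofReal (sparsityWeight M α τ R lam))) :=
        mul_le_mul' (inv_pi_studentMeasure_localBall_le hM hτ) key
    _ = 2 * ENNReal.ofReal c * ((ENNReal.ofReal D)⁻¹ *
          ∫⁻ lam in A, ENNReal.ofReal (sparsityWeight M α τ R lam)) := by rw [mul_assoc]
    _ ≤ _ := by
        refine mul_le_mul' h2c (mul_le_mul' (ENNReal.inv_le_inv.2 ?_) le_rfl)
        exact lintegral_sparsityWeight_le hτ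

/-- If the total weight vanished, the prior would be `∞ • 0 = 0`, yet the domination at `s = 0`
bounds a probability measure by a multiple of it. -/
lemma lintegral_sparsityWeight_ne_zero (hτ : 0 < τ) (hα : 0 < α) (hM : 0 < M)
    (hατ : α ≤ 1 / (4 * M * τ)) (hR : ENNReal.ofReal (2 * M * τ) < R) :
    ∫⁻ lam, ENNReal.ofReal (sparsityWeight M α τ R lam) ≠ 0 := fun h0 => by
  have hp := isProbabilityMeasure_localMeasure hM hτ
  have h := map_localMeasure_le hτ hα hM hατ hR (s := 0) (by simp [l1Norm]) Set.univ
  rw [Measure.map_apply (by fun_prop) MeasurableSet.univ, Set.preimage_univ, measure_univ,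
    Measure.smul_apply, sparsityPrior, Measure.smul_apply,
    withDensity_apply _ MeasurableSet.univ, Measure.restrict_univ, h0] at h
  simp at h

lemma isProbabilityMeasure_sparsityPrior (hτ : 0 < τ) (hα : 0 < α) (hM : 0 < M)
    (hατ : α ≤ 1 / (4 * M * τ)) (hR : ENNReal.ofReal (2 * M * τ) < R) :
    IsProbabilityMeasure (sparsityPrior M α τ R) := by
  constructor
  rw [sparsityPrior, Measure.smul_apply, withDensity_apply _ MeasurableSet.univ,
    Measure.restrict_univ, smul_eq_mul, ENNReal.inv_mul_cancel
      (lintegral_sparsityWeight_ne_zero hτ hα hM hατ hR)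
      ((lintegral_sparsityWeight_le hτ).trans_lt ENNReal.ofReal_lt_top).ne]

lemma ae_sparsityPrior_mem : ∀ᵐ lam ∂(sparsityPrior M α τ R), lam ∈ l1Ball M R := by
  refine Measure.ae_smul_measure ?_ _
  rw [ae_withDensity_iff measurable_sparsityWeight.ennreal_ofReal]
  refine ae_of_all _ fun lam h => ?_
  by_contra hlam
  exact h (by rw [sparsityWeight, Set.indicator_of_notMem hlam, ENNReal.ofReal_zero])

lemma integral_sparsityPrior (hτ : 0 < τ) (u : (Fin M → ℝ) → ℝ) :
    ∫ lam, u lam ∂(sparsityPrior M α τ R) =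
      (∫ lam, sparsityWeight M α τ R lam)⁻¹ * ∫ lam, sparsityWeight M α τ R lam * u lam := by
  rw [sparsityPrior, integral_smul_measure, integral_withDensity_eq_integral_toReal_smul
    measurable_sparsityWeight.ennreal_ofReal (ae_of_all _ fun _ => ENNReal.ofReal_lt_top),
    ENNReal.toReal_inv, ← integral_eq_lintegral_of_nonneg_ae
      (ae_of_all _ (sparsityWeight_nonneg hτ)) measurable_sparsityWeight.aestronglyMeasurable,
    smul_eq_mul]
  simp only [ENNReal.toReal_ofReal (sparsityWeight_nonneg hτ _), smul_eq_mul]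

end Prior

/-! ### Second-order expansion of the loss of the link family -/

lemma ofReal_abs_sum_mul_le {𝒵 : Type*} {n M : ℕ} (Z : Fin n → 𝒵) (φ : Fin M → 𝒵 → ℝ)
    (lam : Fin M → ℝ) (i : Fin n) :
    ENNReal.ofReal |∑ j, lam j * φ j (Z i)| ≤ ENNReal.ofReal (l1Norm lam) * dictSup Z φ := by
  calc ENNReal.ofReal |∑ j, lam j * φ j (Z i)|
      ≤ ENNReal.ofReal (∑ j, |lam j| * |φ j (Z i)|) := by
        refine ENNReal.ofReal_le_ofReal ((Finset.abs_sum_le_sum_abs _ _).trans_eq ?_)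
        exact Finset.sum_congr rfl fun j _ => abs_mul _ _
    _ = ∑ j, ENNReal.ofReal |lam j| * ENNReal.ofReal |φ j (Z i)| := by
        rw [ENNReal.ofReal_sum_of_nonneg fun j _ => by positivity]
        exact Finset.sum_congr rfl fun j _ => ENNReal.ofReal_mul (abs_nonneg _)
    _ ≤ ∑ j, ENNReal.ofReal |lam j| * dictSup Z φ := by
        refine Finset.sum_le_sum fun j _ => mul_le_mul' le_rfl ?_
        exact le_iSup₂ (f := fun i j => ENNReal.ofReal |φ j (Z i)|) i j
    _ = _ := by
        rw [← Finset.sum_mul, l1Norm, ENNReal.ofReal_sum_of_nonneg fun j _ => abs_nonneg _]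

lemma sum_mul_mem_linkInterval {𝒵 : Type*} {n M : ℕ} {Z : Fin n → 𝒵} {φ : Fin M → 𝒵 → ℝ}
    {R : ℝ≥0∞} {lam : Fin M → ℝ} (h : lam ∈ l1Ball M R) (i : Fin n) :
    ∑ j, lam j * φ j (Z i) ∈ linkInterval Z φ R :=
  (ofReal_abs_sum_mul_le Z φ lam i).trans (mul_le_mul' h le_rfl)

lemma convex_linkInterval {𝒵 : Type*} {n M : ℕ} (Z : Fin n → 𝒵) (φ : Fin M → 𝒵 → ℝ) (R : ℝ≥0∞) :
    Convex ℝ (linkInterval Z φ R) := by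
  refine Set.OrdConnected.convex ⟨fun x hx y hy z hz => ?_⟩
  have h1 : |z| ≤ max |x| |y| := abs_le_max_abs_abs hz.1 hz.2
  have hx' : ENNReal.ofReal |x| ≤ R * dictSup Z φ := hx
  have hy' : ENNReal.ofReal |y| ≤ R * dictSup Z φ := hy
  refine (ENNReal.ofReal_le_ofReal h1).trans ?_
  rw [ENNReal.ofReal_max]
  exact max_le hx' hy'

lemma le_supOn {s : Set ℝ} (h : ℝ → ℝ) {x : ℝ} (hx : x ∈ s) : ENNReal.ofReal |h x| ≤ supOn s h :=
  le_iSup₂ (f := fun x (_ : x ∈ s) => ENNReal.ofReal |h x|) x hx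

lemma ofReal_le_linkConst {𝒵 : Type*} {n M : ℕ} (Z : Fin n → 𝒵) (φ : Fin M → 𝒵 → ℝ) (R : ℝ≥0∞)
    (g : ℝ → ℝ) (f : 𝒵 → ℝ) {x : ℝ} (hx : x ∈ linkInterval Z φ R) (i : Fin n) :
    ENNReal.ofReal (deriv g x ^ 2 + |deriv (deriv g) x| * |g x - f (Z i)|) ≤
      linkConst Z φ R g f := by
  unfold linkConst
  split_ifs with hg
  · subst hg
    simp
  · rw [ENNReal.ofReal_add (sq_nonneg _) (by positivity), ← sq_abs,
      ENNReal.ofReal_pow (abs_nonneg _), ENNReal.ofReal_mul (abs_nonneg _)]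
    refine add_le_add (pow_le_pow_left₀ zero_le (le_supOn _ hx) 2)
      (mul_le_mul' (le_supOn _ hx) ?_)
    refine (ENNReal.ofReal_le_ofReal (abs_sub _ _)).trans ?_
    refine ENNReal.ofReal_add_le.trans (add_le_add (le_supOn _ hx) ?_)
    exact le_iSup (fun i => ENNReal.ofReal |f (Z i)|) i

/-- A second-order upper bound for the squared loss on a convex set. -/
lemma sq_sub_le_of_deriv_bound {g : ℝ → ℝ} (hg : ContDiff ℝ 2 g) {s : Set ℝ} (hs : Convex ℝ s)
    {y C : ℝ} (hC : ∀ x ∈ s, deriv g x ^ 2 + |deriv (deriv g) x| * |g x - y| ≤ C)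
    {a b : ℝ} (ha : a ∈ s) (hb : b ∈ s) :
    (g b - y) ^ 2 ≤ (g a - y) ^ 2 + 2 * (g a - y) * deriv g a * (b - a) + C * (b - a) ^ 2 := by
  have hg1 : ∀ x, HasDerivAt g (deriv g x) x := fun x =>
    (hg.differentiable (by norm_num) x).hasDerivAt
  have hg2 : ∀ x, HasDerivAt (deriv g) (deriv (deriv g) x) x := fun x =>
    ((hg.iterate_deriv' 1 1).differentiable (by norm_num) x).hasDerivAt
  -- The hypothesis on `C` makes `H'' ≥ 0` on `s`, so `H` is convex and lies above its tangent at
  -- `a`; this is the claim rearranged.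
  let H : ℝ → ℝ := fun x => C * (x - a) ^ 2 - (g x - y) ^ 2
  let H' : ℝ → ℝ := fun x => 2 * C * (x - a) - 2 * ((g x - y) * deriv g x)
  let H'' : ℝ → ℝ := fun x => 2 * C - 2 * (deriv g x * deriv g x + (g x - y) * deriv (deriv g) x)
  have hH : ∀ x, HasDerivAt H (H' x) x := fun x => by
    have h1 := (((hasDerivAt_id x).sub_const a).pow 2).const_mul C
    have h2 := ((hg1 x).sub_const y).pow 2
    refine (h1.sub h2).congr_deriv ?_
    simp only [H', id]
    norm_num
    ring
  have hH' : ∀ x, HasDerivAt H' (H'' x) x := fun x => by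
    have h1 := ((hasDerivAt_id x).sub_const a).const_mul (2 * C)
    have h2 := (((hg1 x).sub_const y).mul (hg2 x)).const_mul 2
    refine (h1.sub h2).congr_deriv ?_
    simp only [H'']
    ring
  have hconv : ConvexOn ℝ s H := by
    refine convexOn_of_hasDerivWithinAt2_nonneg hs
      (fun x _ => (hH x).continuousAt.continuousWithinAt)
      (fun x _ => (hH x).hasDerivWithinAt) (fun x _ => (hH' x).hasDerivWithinAt) fun x hx => ?_
    have h1 := hC x (interior_subset hx)
    have h2 : (g x - y) * deriv (deriv g) x ≤ |deriv (deriv g) x| * |g x - y| := by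
      rw [← abs_mul, mul_comm]; exact le_abs_self _
    simp only [H'']
    nlinarith
  have key : H' a * (b - a) ≤ H b - H a := by
    rcases lt_trichotomy a b with hab | rfl | hab
    · have := hconv.le_slope_of_hasDerivAt ha hb hab (hH a)
      rwa [slope_def_field, le_div_iff₀ (sub_pos.2 hab)] at this
    · simp
    · have := hconv.slope_le_of_hasDerivAt hb ha hab (hH a)
      rw [slope_def_field, div_le_iff₀ (sub_pos.2 hab)] at this
      linarith
  simp only [H, H'] at key
  linarith

/-- In the second-order expansion of the loss around `a`, the linear term is centred under
`localMeasure`, and the quadratic term has no cross covariances. -/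
lemma integral_sq_link_le {g : ℝ → ℝ} (hg : ContDiff ℝ 2 g) {M : ℕ} (hM : 0 < M) {τ : ℝ}
    (hτ : 0 < τ) {s : Set ℝ} (hs : Convex ℝ s) {y C : ℝ}
    (hC : ∀ x ∈ s, deriv g x ^ 2 + |deriv (deriv g) x| * |g x - y| ≤ C)
    (lam c : Fin M → ℝ) (hmem : ∀ u ∈ localBall M τ, ∑ j, (lam + u) j * c j ∈ s) :
    ∫ u, (g (∑ j, (lam + u) j * c j) - y) ^ 2 ∂(localMeasure M τ) ≤
      (g (∑ j, lam j * c j) - y) ^ 2 + C * (2 * τ ^ 2 * ∑ j, c j ^ 2) := by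
  have := isProbabilityMeasure_localMeasure hM hτ
  set a := ∑ j, lam j * c j with ha
  have h0 : (0 : Fin M → ℝ) ∈ localBall M τ := by
    have : l1Norm (0 : Fin M → ℝ) ≤ 2 * M * τ := by simp only [l1Norm]; simp; positivity
    exact this
  have has : a ∈ s := by simpa using hmem 0 h0
  have hC0 : 0 ≤ C := le_trans (by positivity) (hC a has)
  have hsplit : ∀ u : Fin M → ℝ, ∑ j, (lam + u) j * c j - a = ∑ j, u j * c j := fun u => by
    rw [ha, ← Finset.sum_sub_distrib]
    exact Finset.sum_congr rfl fun j _ => by simp only [Pi.add_apply]; ring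
  have hlin : Integrable (fun u : Fin M → ℝ => ∑ j, u j * c j) (localMeasure M τ) :=
    integrable_finsetSum _ fun j _ => (integrable_apply_localMeasure hM hτ j).mul_const _
  have hsq : Integrable (fun u : Fin M → ℝ => (∑ j, u j * c j) ^ 2) (localMeasure M τ) := by
    have h1 : ∀ u : Fin M → ℝ, (∑ j, u j * c j) ^ 2 = ∑ j, ∑ k, c j * c k * (u j * u k) :=
      fun u => by
        rw [sq, Finset.sum_mul_sum]
        exact Finset.sum_congr rfl fun j _ => Finset.sum_congr rfl fun k _ => by ring
    simp only [h1]
    exact integrable_finsetSum _ fun j _ => integrable_finsetSum _ fun k _ =>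
      (integrable_mul_localMeasure hM hτ j k).const_mul (c j * c k)
  have hR : Integrable (fun u : Fin M → ℝ => (g a - y) ^ 2 +
      2 * (g a - y) * deriv g a * ∑ j, u j * c j + C * (∑ j, u j * c j) ^ 2)
        (localMeasure M τ) :=
    ((integrable_const _).add (hlin.const_mul _)).add (hsq.const_mul _)
  have hae : ∀ᵐ u ∂(localMeasure M τ), (g (∑ j, (lam + u) j * c j) - y) ^ 2 ≤ (g a - y) ^ 2 +
      2 * (g a - y) * deriv g a * ∑ j, u j * c j + C * (∑ j, u j * c j) ^ 2 := by
    filter_upwards [ae_localMeasure_mem M τ] with u hu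
    have h1 := sq_sub_le_of_deriv_bound hg hs hC has (hmem u hu)
    rwa [hsplit u] at h1
  refine (integral_mono_of_nonneg (ae_of_all _ fun u => sq_nonneg _) hR hae).trans ?_
  have hl1 : Integrable (fun u : Fin M → ℝ => (g a - y) ^ 2 +
      2 * (g a - y) * deriv g a * ∑ j, u j * c j) (localMeasure M τ) :=
    (integrable_const _).add (hlin.const_mul _)
  rw [integral_add hl1 (hsq.const_mul _), integral_add (integrable_const _) (hlin.const_mul _),
    integral_const_mul, integral_const_mul, integral_linear_localMeasure hM hτ]
  simp only [integral_const, probReal_univ, one_smul, mul_zero, add_zero]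
  gcongr
  exact integral_linear_sq_localMeasure_le hM hτ c

/-! ### The aggregate as a Gibbs mean -/

/-- Since `‖Y - F‖² = ‖x‖² + (‖h‖² - 2⟨x, h⟩)`, the two weights differ by the factor `exp c`, which
does not depend on `λ` and cancels in the normalisation. -/
lemma ewa_sub_eq_gibbsMean {𝒵 Λ : Type*} [MeasurableSpace Λ] {n : ℕ} {Z : Fin n → 𝒵}
    {F : Λ → 𝒵 → ℝ} {f : 𝒵 → ℝ} {π : Measure Λ} [IsProbabilityMeasure π] {h : Λ → Fin n → ℝ}
    (hm : Measurable h) {β C : ℝ} (hβ : 0 < β) (hC : ∀ lam i, |h lam i| ≤ C)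
    (hae : ∀ᵐ lam ∂π, ∀ i, h lam i = F lam (Z i) - f (Z i)) {Y x : Fin n → ℝ}
    (hY : ∀ i, Y i = f (Z i) + x i) (i : Fin n) :
    ewa Z F π β Y (Z i) - f (Z i) = gibbsMean π h β x i := by
  have hpos := integral_exp_pos_of_abs_le (π := π) (measurable_potential β 1 measurable_const hm)
    fun lam => abs_potential_le hβ x (hC lam)
  set c := -(β⁻¹ * ∑ i, x i ^ 2) with hc
  have hpot : ∀ᵐ lam ∂π, Real.exp (-(β⁻¹ * ∑ i, (Y i - F lam (Z i)) ^ 2)) =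
      Real.exp (potential β 1 x (h lam)) * Real.exp c := by
    filter_upwards [hae] with lam hlam
    rw [← Real.exp_add, hc, potential, ← neg_add, ← mul_add, ← Finset.sum_add_distrib]
    congr 3
    refine Finset.sum_congr rfl fun i _ => ?_
    rw [hlam i, hY i]
    ring
  have hden : ∫ lam, Real.exp (-(β⁻¹ * ∑ i, (Y i - F lam (Z i)) ^ 2)) ∂π =
      (∫ lam, Real.exp (potential β 1 x (h lam)) ∂π) * Real.exp c := by
    rw [integral_congr_ae hpot, integral_mul_const]
  have h1 : ewa Z F π β Y (Z i) = ∫ lam, (gibbsDensity π h β x lam * h lam i +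
      gibbsDensity π h β x lam * f (Z i)) ∂π := by
    rw [ewa, posterior, integral_tilted]
    refine integral_congr_ae ?_
    filter_upwards [hae, hpot] with lam hlam hp
    rw [hp, hden, mul_div_mul_right _ _ (Real.exp_pos c).ne', gibbsDensity, logPartition,
      Real.exp_sub, Real.exp_log hpos, hlam i, smul_eq_mul]
    ring
  rw [h1, integral_add (integrable_gibbsDensity_mul hm hβ hC x (by fun_prop) fun lam => hC lam i)
    (integrable_gibbsDensity_mul hm hβ hC x measurable_const fun _ => le_rfl), integral_mul_const,
    integral_gibbsDensity hm hβ hC, one_mul, add_sub_cancel_right, gibbsMean]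

lemma isCompact_l1Ball (M : ℕ) {R : ℝ≥0∞} (hR : R ≠ ∞) : IsCompact (l1Ball M R) := by
  refine Metric.isCompact_of_isClosed_isBounded (isClosed_l1Ball M R) ?_
  refine (Metric.isBounded_closedBall (x := 0) (r := R.toReal)).subset fun lam hlam => ?_
  have h1 : l1Norm lam ≤ R.toReal := (ENNReal.ofReal_le_iff_le_toReal hR).1 hlam
  rw [mem_closedBall_zero_iff, pi_norm_le_iff_of_nonneg ENNReal.toReal_nonneg]
  exact fun j => (abs_le_l1Norm lam j).trans h1

lemma continuous_linkFamily {𝒵 : Type*} {M : ℕ} {g : ℝ → ℝ} (hg : Continuous g)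
    (φ : Fin M → 𝒵 → ℝ) (z : 𝒵) : Continuous fun lam => linkFamily g φ lam z := by
  unfold linkFamily; fun_prop

/-! ### The sparsity oracle inequality on a bounded `ℓ¹` ball -/

/-- The condition on `β` says that the slopes `(2/β)(h - m)` stay in the range where the noise
assumption applies; for `t₀ = ∞` there is nothing to check. -/
lemma ofReal_le_of_spread_le {t₀ : ℝ≥0∞} (ht₀ : 0 < t₀) {β L : ℝ} (hβ : 0 < β)
    (h : 2 * ENNReal.ofReal L / t₀ ≤ ENNReal.ofReal β) : ENNReal.ofReal (2 * β⁻¹ * L) ≤ t₀ := by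
  rcases eq_or_ne t₀ ∞ with rfl | htop
  · exact le_top
  · rw [ENNReal.div_le_iff ht₀.ne' htop] at h
    have h1 : ENNReal.ofReal (2 * β⁻¹ * L) = (ENNReal.ofReal β)⁻¹ * (2 * ENNReal.ofReal L) := by
      rw [← ENNReal.ofReal_inv_of_pos hβ, show (2 : ℝ≥0∞) = ENNReal.ofReal 2 by simp,
        ← ENNReal.ofReal_mul zero_le_two, ← ENNReal.ofReal_mul (inv_pos.2 hβ).le]
      congr 1
      ring
    have h2 : ENNReal.ofReal β ≠ 0 := by simpa using hβ
    rw [h1]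
    calc _ ≤ (ENNReal.ofReal β)⁻¹ * (ENNReal.ofReal β * t₀) := by gcongr
      _ = t₀ := by rw [← mul_assoc, ENNReal.inv_mul_cancel h2 ENNReal.ofReal_ne_top, one_mul]

lemma map_noise_eq_pi {Ω : Type*} [MeasurableSpace Ω] {P : Measure Ω} [IsProbabilityMeasure P]
    {ν : Measure ℝ} {n : ℕ} {ξ : Fin n → Ω → ℝ} (hlaw : ∀ i, HasLaw (ξ i) ν P)
    (hind : iIndepFun ξ P) : P.map (fun ω i => ξ i ω) = Measure.pi fun _ => ν := by
  rw [(iIndepFun_iff_map_fun_eq_pi_map fun i => (hlaw i).aemeasurable).1 hind]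
  exact congrArg Measure.pi (funext fun i => (hlaw i).map_eq)

lemma lintegral_empNormSq_ewa_le_of_ne_top {𝒵 : Type*} {n M : ℕ} (hn : 0 < n) (hM : 0 < M)
    (Z : Fin n → 𝒵) (φ : Fin M → 𝒵 → ℝ) (f : 𝒵 → ℝ)
    (hφ : ∀ j, (1 / (n : ℝ)) * ∑ i, φ j (Z i) ^ 2 = 1)
    {g : ℝ → ℝ} (hg : ContDiff ℝ 2 g)
    {Ω : Type*} [MeasurableSpace Ω] {P : Measure Ω} [IsProbabilityMeasure P]
    {ν : Measure ℝ} [IsProbabilityMeasure ν] {ξ : Fin n → Ω → ℝ}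
    (hξ_law : ∀ i, HasLaw (ξ i) ν P) (hξ_indep : iIndepFun ξ P)
    (hν_int : Integrable (fun x : ℝ => x) ν) (hν_mean : ∫ x, x ∂ν = 0)
    {t₀ : ℝ≥0∞} {v : ℝ → ℝ≥0} (hN : AssumptionN ν t₀ v)
    {Y : Fin n → Ω → ℝ} (hY : ∀ i ω, Y i ω = f (Z i) + ξ i ω)
    {R : ℝ≥0∞} (hRtop : R ≠ ∞) {α τ β : ℝ} (hα : 0 < α) (hτ : 0 < τ) (hβ : 0 < β)
    (hβ_ge : max (4 * supNorm v) (2 * spread Z (linkFamily g φ) (l1Ball M R) / t₀) ≤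
      ENNReal.ofReal β)
    (hR : ENNReal.ofReal (2 * M * τ) < R) (hατ : α ≤ 1 / (4 * M * τ))
    (lamStar : Fin M → ℝ)
    (hlamStar : ENNReal.ofReal (l1Norm lamStar) ≤ R - ENNReal.ofReal (2 * M * τ)) :
    ∫⁻ ω, ENNReal.ofReal (empNormSq Z (fun z =>
        ewa Z (linkFamily g φ) (sparsityPrior M α τ R) β (fun i => Y i ω) z - f z)) ∂P ≤
      ENNReal.ofReal
        (empNormSq Z (fun z => linkFamily g φ lamStar z - f z)
          + 4 * β / n * ∑ j, Real.log (1 + |lamStar j| / τ)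
          + 2 * β * (α * l1Norm lamStar + 1) / n)
      + ENNReal.ofReal (4 * Real.exp 1 * τ ^ 2 * M) * linkConst Z φ R g f := by
  classical
  have hM' : (0 : ℝ) < M := by exact_mod_cast hM
  have hn' : (0 : ℝ) < n := by exact_mod_cast hn
  -- An infinite constant makes the right-hand side infinite, because its coefficient is positive.
  rcases eq_or_ne (linkConst Z φ R g f) ∞ with hCtop | hCtop
  · have h1 : ENNReal.ofReal (4 * Real.exp 1 * τ ^ 2 * M) ≠ 0 := by
      rw [Ne, ENNReal.ofReal_eq_zero, not_le]; positivity
    rw [hCtop, ENNReal.mul_top h1, add_top]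
    exact le_top
  have hprob := isProbabilityMeasure_sparsityPrior hτ hα hM hατ hR
  have hprobloc := isProbabilityMeasure_localMeasure hM hτ
  set π := sparsityPrior M α τ R with hπ
  set S := l1Ball M R with hS
  have hSm : MeasurableSet S := (isClosed_l1Ball M R).measurableSet
  have hS0 : (0 : Fin M → ℝ) ∈ S := by
    have : ENNReal.ofReal (l1Norm (0 : Fin M → ℝ)) ≤ R := by simp [l1Norm]
    exact this
  let F : (Fin M → ℝ) → 𝒵 → ℝ := linkFamily g φ
  have hFc : ∀ z, Continuous fun lam => F lam z := continuous_linkFamily hg.continuous φ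
  -- Off the ball, which the prior does not charge, the error is replaced by its value at `λ = 0`.
  -- This makes it bounded, with spread at most `L`, everywhere and not just almost everywhere.
  let h : (Fin M → ℝ) → Fin n → ℝ := fun lam i =>
    S.piecewise (fun lam => F lam (Z i) - f (Z i)) (fun _ => F 0 (Z i) - f (Z i)) lam
  have hmem : ∀ lam, ∃ lam' ∈ S, ∀ i, h lam i = F lam' (Z i) - f (Z i) := fun lam => by
    by_cases hlam : lam ∈ S
    · exact ⟨lam, hlam, fun i => Set.piecewise_eq_of_mem _ _ _ hlam⟩
    · exact ⟨0, hS0, fun i => Set.piecewise_eq_of_notMem _ _ _ hlam⟩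
  have hhS : ∀ lam ∈ S, ∀ i, h lam i = F lam (Z i) - f (Z i) := fun lam hlam i =>
    Set.piecewise_eq_of_mem _ _ _ hlam
  have hm : Measurable h := measurable_pi_iff.2 fun i =>
    Measurable.piecewise hSm ((hFc (Z i)).measurable.sub_const _) measurable_const
  obtain ⟨C, hC⟩ : ∃ C, ∀ lam i, |h lam i| ≤ C := by
    have h1 : ∀ i, ∃ C, ∀ lam ∈ S, ‖F lam (Z i) - f (Z i)‖ ≤ C := fun i =>
      (isCompact_l1Ball M hRtop).exists_bound_of_continuousOn
        ((hFc (Z i)).sub continuous_const).continuousOn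
    choose C hC using h1
    refine ⟨∑ i, |C i|, fun lam i => ?_⟩
    obtain ⟨lam', hlam', h2⟩ := hmem lam
    rw [h2 i]
    exact (hC i lam' hlam').trans ((le_abs_self _).trans
      (Finset.single_le_sum (f := fun i => |C i|) (fun _ _ => abs_nonneg _) (Finset.mem_univ i)))
  have hspread : ∀ lam ∈ S, ∀ lam' ∈ S, ∀ i,
      ENNReal.ofReal |F lam (Z i) - F lam' (Z i)| ≤ spread Z F S := fun lam hlam lam' hlam' i =>
    (le_iSup (fun i => ENNReal.ofReal |F lam (Z i) - F lam' (Z i)|) i).trans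
      ((le_iSup₂ (f := fun lam' (_ : lam' ∈ S) =>
        ⨆ i, ENNReal.ofReal |F lam (Z i) - F lam' (Z i)|) lam' hlam').trans
        (le_iSup₂ (f := fun lam (_ : lam ∈ S) => ⨆ lam' ∈ S,
          ⨆ i, ENNReal.ofReal |F lam (Z i) - F lam' (Z i)|) lam hlam))
  have hspread_ne : spread Z F S ≠ ∞ := by
    refine ne_top_of_le_ne_top (b := ENNReal.ofReal (2 * C)) ENNReal.ofReal_ne_top ?_
    refine iSup₂_le fun lam hlam => iSup₂_le fun lam' hlam' => iSup_le fun i =>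
      ENNReal.ofReal_le_ofReal ?_
    have h1 := hC lam i
    have h2 := hC lam' i
    rw [hhS lam hlam] at h1
    rw [hhS lam' hlam'] at h2
    rw [abs_le] at *
    constructor <;> linarith
  set L := (spread Z F S).toReal with hLdef
  have hL : ∀ lam lam' i, |h lam i - h lam' i| ≤ L := fun lam lam' i => by
    obtain ⟨l1, hl1, h1⟩ := hmem lam
    obtain ⟨l2, hl2, h2⟩ := hmem lam'
    rw [h1 i, h2 i, sub_sub_sub_cancel_right]
    exact (ENNReal.ofReal_le_iff_le_toReal hspread_ne).1 (hspread l1 hl1 l2 hl2 i)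
  have hβv : ∀ a, 4 * (v a : ℝ) ≤ β := fun a => by
    have h1 : 4 * (v a : ℝ≥0∞) ≤ ENNReal.ofReal β :=
      le_trans (mul_le_mul' le_rfl (le_iSup (fun a => (v a : ℝ≥0∞)) a))
        ((le_max_left _ _).trans hβ_ge)
    have h2 := ENNReal.toReal_mono ENNReal.ofReal_ne_top h1
    rw [ENNReal.toReal_ofReal hβ.le, ENNReal.toReal_mul] at h2
    simpa using h2
  have hβL : ENNReal.ofReal (2 * β⁻¹ * L) ≤ t₀ := by
    refine ofReal_le_of_spread_le hN.t₀_pos hβ ?_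
    rw [hLdef, ENNReal.ofReal_toReal hspread_ne]
    exact (le_max_right _ _).trans hβ_ge
  have hae : ∀ᵐ lam ∂π, ∀ i, h lam i = F lam (Z i) - f (Z i) := by
    filter_upwards [ae_sparsityPrior_mem] with lam hlam using hhS lam hlam
  -- the oracle inequality at the translated local measure
  have hshift : Measurable fun u : Fin M → ℝ => lamStar + u := measurable_const_add lamStar
  have hpprob : IsProbabilityMeasure ((localMeasure M τ).map fun u => lamStar + u) :=
    Measure.isProbabilityMeasure_map hshift.aemeasurable
  have horacle := hN.integral_gibbsMean_sq_le_of_le hν_int hν_mean hm hβ hC hL hβv hβL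
    (map_localMeasure_le hτ hα hM hατ hR hlamStar)
  -- the approximation term
  set K := (linkConst Z φ R g f).toReal with hK
  have hK0 : 0 ≤ K := ENNReal.toReal_nonneg
  have hKb : ∀ i, ∀ x ∈ linkInterval Z φ R,
      deriv g x ^ 2 + |deriv (deriv g) x| * |g x - f (Z i)| ≤ K := fun i x hx =>
    (ENNReal.ofReal_le_iff_le_toReal hCtop).1 (ofReal_le_linkConst Z φ R g f hx i)
  have hterm : ∀ i, ∫ u, h (lamStar + u) i ^ 2 ∂(localMeasure M τ) ≤
      (F lamStar (Z i) - f (Z i)) ^ 2 + K * (2 * τ ^ 2 * ∑ j, φ j (Z i) ^ 2) := fun i => by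
    have h1 : ∫ u, h (lamStar + u) i ^ 2 ∂(localMeasure M τ) =
        ∫ u, (g (∑ j, (lamStar + u) j * φ j (Z i)) - f (Z i)) ^ 2 ∂(localMeasure M τ) := by
      refine integral_congr_ae ?_
      filter_upwards [ae_localMeasure_mem M τ] with u hu
      rw [hhS _ (add_mem_l1Ball hR hlamStar hu)]
      rfl
    rw [h1]
    exact integral_sq_link_le hg hM hτ (convex_linkInterval Z φ R) (hKb i) lamStar
      (fun j => φ j (Z i)) fun u hu =>
        sum_mul_mem_linkInterval (add_mem_l1Ball hR hlamStar hu) i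
  have hsq : ∀ i, Integrable (fun u => h (lamStar + u) i ^ 2) (localMeasure M τ) := fun i =>
    integrable_of_abs_le (by fun_prop) (K := C ^ 2) fun u => by
      rw [abs_pow]; exact pow_le_pow_left₀ (abs_nonneg _) (hC _ i) 2
  -- The normalisation of the dictionary enters only here; it turns the sum of the variance terms
  -- into `n M`.
  have hφsum : ∑ i, ∑ j, φ j (Z i) ^ 2 = n * M := by
    rw [Finset.sum_comm]
    have h1 : ∀ j, ∑ i, φ j (Z i) ^ 2 = n := fun j => by
      have := hφ j
      field_simp at this
      exact this
    simp only [h1, Finset.sum_const, Finset.card_univ, Fintype.card_fin, nsmul_eq_mul]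
    ring
  have happrox : ∫ lam, ∑ i, h lam i ^ 2 ∂((localMeasure M τ).map fun u => lamStar + u) ≤
      ∑ i, (F lamStar (Z i) - f (Z i)) ^ 2 + K * (2 * τ ^ 2 * (n * M)) := by
    rw [integral_map hshift.aemeasurable (by fun_prop), integral_finsetSum _ fun i _ => hsq i,
      ← hφsum, Finset.mul_sum, Finset.mul_sum, ← Finset.sum_add_distrib]
    exact Finset.sum_le_sum fun i _ => hterm i
  -- the expected loss
  have hξm : AEMeasurable (fun ω i => ξ i ω) P :=
    aemeasurable_pi_iff.2 fun i => (hξ_law i).aemeasurable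
  have hgm : Measurable fun x => ENNReal.ofReal ((1 / (n : ℝ)) * ∑ i, gibbsMean π h β x i ^ 2) := by
    have := measurable_gibbsMean (π := π) (β := β) hm
    fun_prop
  have hloss : ∀ ω, empNormSq Z (fun z => ewa Z F π β (fun i => Y i ω) z - f z) =
      (1 / (n : ℝ)) * ∑ i, gibbsMean π h β (fun i => ξ i ω) i ^ 2 := fun ω => by
    unfold empNormSq
    congr 1
    refine Finset.sum_congr rfl fun i _ => ?_
    exact congrArg (· ^ 2) (ewa_sub_eq_gibbsMean hm hβ hC hae (fun i => hY i ω) i)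
  calc ∫⁻ ω, ENNReal.ofReal (empNormSq Z (fun z => ewa Z F π β (fun i => Y i ω) z - f z)) ∂P
      = ∫⁻ x, ENNReal.ofReal ((1 / (n : ℝ)) * ∑ i, gibbsMean π h β x i ^ 2)
          ∂(Measure.pi fun _ => ν) := by
        simp only [hloss]
        rw [← map_noise_eq_pi hξ_law hξ_indep, lintegral_map' hgm.aemeasurable hξm]
    _ = ENNReal.ofReal ((1 / (n : ℝ)) * ∫ x, ∑ i, gibbsMean π h β x i ^ 2
          ∂(Measure.pi fun _ => ν)) := by
        rw [← integral_const_mul, ofReal_integral_eq_lintegral_ofReal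
          ((integrable_gibbsMean_sq hm hβ hC).const_mul _)
          (ae_of_all _ fun x => by
            exact mul_nonneg (by positivity) (Finset.sum_nonneg fun i _ => sq_nonneg _))]
    _ ≤ ENNReal.ofReal ((empNormSq Z (fun z => linkFamily g φ lamStar z - f z)
          + 4 * β / n * ∑ j, Real.log (1 + |lamStar j| / τ)
          + 2 * β * (α * l1Norm lamStar + 1) / n) + 4 * Real.exp 1 * τ ^ 2 * M * K) := by
        refine ENNReal.ofReal_le_ofReal ?_
        have h1 := mul_le_mul_of_nonneg_left (horacle.trans (add_le_add happrox le_rfl))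
          (show (0 : ℝ) ≤ 1 / n by positivity)
        refine h1.trans ?_
        have h2 : (1 : ℝ) / n * (∑ i, (F lamStar (Z i) - f (Z i)) ^ 2 +
            K * (2 * τ ^ 2 * (n * M)) + β * (4 * ∑ j, Real.log (1 + |lamStar j| / τ) +
              2 * (α * l1Norm lamStar + 1))) =
            empNormSq Z (fun z => linkFamily g φ lamStar z - f z)
          + 4 * β / n * ∑ j, Real.log (1 + |lamStar j| / τ)
          + 2 * β * (α * l1Norm lamStar + 1) / n + 2 * τ ^ 2 * M * K := by
          simp only [empNormSq, F]
          field_simp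
          ring
        rw [h2]
        -- The argument gives the constant `2`, which is weaker than needed only by comparison with
        -- `4e`: the slack is discarded.
        have h3 : 2 * τ ^ 2 * M * K ≤ 4 * Real.exp 1 * τ ^ 2 * M * K := by
          have h4 := Real.add_one_le_exp (1 : ℝ)
          have h5 : (2 : ℝ) ≤ 4 * Real.exp 1 := by linarith
          gcongr
        linarith
    _ ≤ _ := by
        refine ENNReal.ofReal_add_le.trans (add_le_add le_rfl ?_)
        rw [ENNReal.ofReal_mul (by positivity), hK, ENNReal.ofReal_toReal hCtop]

/-! ### The aggregate for an unbounded family -/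

section Posterior

variable {𝒵 : Type*} {n : ℕ} {Z : Fin n → 𝒵}

lemma exp_neg_sq_loss_le_one {β : ℝ} (hβ : 0 < β) (y w : Fin n → ℝ) :
    Real.exp (-(β⁻¹ * ∑ i, (y i - w i) ^ 2)) ≤ 1 := by
  refine Real.exp_le_one_iff.2 (neg_nonpos.2 (mul_nonneg (inv_pos.2 hβ).le ?_))
  exact Finset.sum_nonneg fun i _ => sq_nonneg _

/-- The Gaussian weight tames any family. The residual satisfies `t² ≤ β s`, hence `t ≤ (β+1)(s+1)`,
and `s + 1 ≤ exp s`. The bound is uniform in `w`, so the aggregate exists and passes to the limit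
even for unbounded families. -/
lemma abs_exp_neg_sq_loss_mul_le {β : ℝ} (hβ : 0 < β) (y w : Fin n → ℝ) (i : Fin n) :
    |Real.exp (-(β⁻¹ * ∑ i, (y i - w i) ^ 2)) * w i| ≤ |y i| + (β + 1) := by
  set s := β⁻¹ * ∑ i, (y i - w i) ^ 2 with hs
  set t := |y i - w i| with ht
  have ht0 : 0 ≤ t := abs_nonneg _
  have hst : β⁻¹ * t ^ 2 ≤ s := by
    rw [hs, ht, sq_abs]
    exact mul_le_mul_of_nonneg_left (Finset.single_le_sum
      (f := fun i => (y i - w i) ^ 2) (fun _ _ => sq_nonneg _) (Finset.mem_univ i))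
      (inv_pos.2 hβ).le
  have hE := Real.exp_pos (-s)
  have hE1 : Real.exp (-s) ≤ 1 := exp_neg_sq_loss_le_one hβ y w
  have hEt : Real.exp (-s) * t ≤ β + 1 := by
    have h1 : t ≤ (β + 1) * (s + 1) := by
      have h2 : t ^ 2 ≤ β * s := by
        have := mul_le_mul_of_nonneg_left hst hβ.le
        rwa [mul_inv_cancel_left₀ hβ.ne'] at this
      have hs0 : 0 ≤ s := le_trans (by positivity) hst
      nlinarith [sq_nonneg (t - 1)]
    have h3 : s + 1 ≤ Real.exp s := Real.add_one_le_exp s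
    have h4 : Real.exp (-s) * Real.exp s = 1 := by rw [← Real.exp_add]; simp
    calc Real.exp (-s) * t ≤ Real.exp (-s) * ((β + 1) * Real.exp s) := by gcongr; nlinarith
      _ = β + 1 := by rw [mul_left_comm, h4, mul_one]
  have hw : |w i| ≤ |y i| + t := by
    have := abs_sub (y i) (y i - w i)
    rwa [sub_sub_cancel] at this
  rw [abs_mul, abs_of_pos hE]
  nlinarith [mul_le_mul_of_nonneg_left hw hE.le, mul_le_mul_of_nonneg_right hE1 (abs_nonneg (y i))]

variable {Λ : Type*} [MeasurableSpace Λ] {π : Measure Λ} [IsProbabilityMeasure π]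
  {F : Λ → 𝒵 → ℝ} {β : ℝ}

lemma integrable_posterior (hF : ∀ i, Measurable fun lam => F lam (Z i)) (hβ : 0 < β)
    (y : Fin n → ℝ) (i : Fin n) :
    Integrable (fun lam => F lam (Z i)) (posterior Z F π β y) := by
  have hE : Integrable (fun lam => Real.exp (-(β⁻¹ * ∑ i, (y i - F lam (Z i)) ^ 2))) π :=
    integrable_of_abs_le (by fun_prop) (K := 1) fun lam => by
      rw [abs_of_pos (Real.exp_pos _)]
      exact exp_neg_sq_loss_le_one hβ y fun i => F lam (Z i)
  rw [posterior, integrable_tilted_iff hE]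
  exact integrable_of_abs_le (by simp only [smul_eq_mul]; fun_prop)
    fun lam => abs_exp_neg_sq_loss_mul_le hβ y (fun i => F lam (Z i)) i

lemma measurable_ewa (hF : ∀ i, Measurable fun lam => F lam (Z i)) (i : Fin n) :
    Measurable fun y => ewa Z F π β y (Z i) := by
  simp only [ewa, posterior, integral_tilted]
  have h1 : Measurable fun q : (Fin n → ℝ) × Λ =>
      Real.exp (-(β⁻¹ * ∑ i, (q.1 i - F q.2 (Z i)) ^ 2)) := by fun_prop
  have h2 : Measurable fun y : Fin n → ℝ =>
      ∫ lam, Real.exp (-(β⁻¹ * ∑ i, (y i - F lam (Z i)) ^ 2)) ∂π :=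
    (h1.stronglyMeasurable.integral_prod_right (ν := π)).measurable
  have h3 : Measurable fun q : (Fin n → ℝ) × Λ =>
      (Real.exp (-(β⁻¹ * ∑ i, (q.1 i - F q.2 (Z i)) ^ 2)) /
        ∫ lam, Real.exp (-(β⁻¹ * ∑ i, (q.1 i - F lam (Z i)) ^ 2)) ∂π) • F q.2 (Z i) :=
    (h1.div (h2.comp measurable_fst)).smul ((hF i).comp measurable_snd)
  exact (h3.stronglyMeasurable.integral_prod_right (ν := π)).measurable

omit [IsProbabilityMeasure π] in
lemma ewa_eq_div (y : Fin n → ℝ) (z : 𝒵) :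
    ewa Z F π β y z = (∫ lam, Real.exp (-(β⁻¹ * ∑ i, (y i - F lam (Z i)) ^ 2)) * F lam z ∂π) /
      ∫ lam, Real.exp (-(β⁻¹ * ∑ i, (y i - F lam (Z i)) ^ 2)) ∂π := by
  rw [ewa, posterior, integral_tilted, ← integral_div]
  refine integral_congr_ae (ae_of_all _ fun lam => ?_)
  simp only [smul_eq_mul]
  ring

end Posterior

/-! ### Truncation of the prior -/

section Truncation

variable {M : ℕ} {α τ : ℝ}

lemma tendsto_sparsityWeight (lam : Fin M → ℝ) :
    ∀ᶠ k : ℕ in atTop, sparsityWeight M α τ k lam = sparsityWeight M α τ ∞ lam := by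
  obtain ⟨k₀, hk₀⟩ := exists_nat_ge (l1Norm lam)
  filter_upwards [eventually_ge_atTop k₀] with k hk
  have h1 : lam ∈ l1Ball M (k : ℝ≥0∞) := by
    have : ENNReal.ofReal (l1Norm lam) ≤ (k : ℝ≥0∞) := by
      rw [← ENNReal.ofReal_natCast]
      exact ENNReal.ofReal_le_ofReal (hk₀.trans (by exact_mod_cast hk))
    exact this
  have h2 : lam ∈ l1Ball M ∞ := (le_top : ENNReal.ofReal (l1Norm lam) ≤ ∞)
  rw [sparsityWeight_eq lam h1, sparsityWeight_eq lam h2]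

lemma sparsityWeight_mono (hτ : 0 < τ) {R R' : ℝ≥0∞} (hR : R ≤ R') (lam : Fin M → ℝ) :
    sparsityWeight M α τ R lam ≤ sparsityWeight M α τ R' lam := by
  by_cases h : lam ∈ l1Ball M R
  · have h' : lam ∈ l1Ball M R' := le_trans (show ENNReal.ofReal (l1Norm lam) ≤ R from h) hR
    rw [sparsityWeight_eq lam h, sparsityWeight_eq lam h']
  · rw [sparsityWeight, Set.indicator_of_notMem h]
    exact sparsityWeight_nonneg hτ lam

lemma tendsto_integral_sparsityWeight (hτ : 0 < τ) {u : (Fin M → ℝ) → ℝ} (hu : Measurable u)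
    {K : ℝ} (hK : ∀ lam, |u lam| ≤ K) :
    Tendsto (fun k : ℕ => ∫ lam, sparsityWeight M α τ k lam * u lam) atTop
      (𝓝 (∫ lam, sparsityWeight M α τ ∞ lam * u lam)) := by
  refine tendsto_integral_of_dominated_convergence (fun lam => sparsityWeight M α τ ∞ lam * K)
    (fun k => (measurable_sparsityWeight.mul hu).aestronglyMeasurable)
    ((integrable_sparsityWeight hτ).mul_const K) (fun k => ae_of_all _ fun lam => ?_)
    (ae_of_all _ fun lam => ?_)
  · rw [norm_mul, Real.norm_of_nonneg (sparsityWeight_nonneg hτ lam)]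
    exact mul_le_mul (sparsityWeight_mono hτ le_top lam) (hK lam) (abs_nonneg _)
      (sparsityWeight_nonneg hτ lam)
  · refine tendsto_const_nhds.congr' ?_
    filter_upwards [tendsto_sparsityWeight (α := α) (τ := τ) lam] with k hk
    rw [hk]

lemma integral_sparsityWeight_ne_zero (hτ : 0 < τ) (hα : 0 < α) (hM : 0 < M)
    (hατ : α ≤ 1 / (4 * M * τ)) {R : ℝ≥0∞} (hR : ENNReal.ofReal (2 * M * τ) < R) :
    ∫ lam, sparsityWeight M α τ R lam ≠ 0 := by
  rw [integral_eq_lintegral_of_nonneg_ae (ae_of_all _ (sparsityWeight_nonneg hτ))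
    measurable_sparsityWeight.aestronglyMeasurable]
  exact (ENNReal.toReal_pos (lintegral_sparsityWeight_ne_zero hτ hα hM hατ hR)
    ((lintegral_sparsityWeight_le hτ).trans_lt ENNReal.ofReal_lt_top).ne).ne'

lemma tendsto_integral_sparsityPrior (hτ : 0 < τ) (hα : 0 < α) (hM : 0 < M)
    (hατ : α ≤ 1 / (4 * M * τ)) {u : (Fin M → ℝ) → ℝ} (hu : Measurable u)
    {K : ℝ} (hK : ∀ lam, |u lam| ≤ K) :
    Tendsto (fun k : ℕ => ∫ lam, u lam ∂(sparsityPrior M α τ k)) atTop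
      (𝓝 (∫ lam, u lam ∂(sparsityPrior M α τ ∞))) := by
  simp only [integral_sparsityPrior hτ]
  refine Tendsto.mul (Tendsto.inv₀ ?_ (integral_sparsityWeight_ne_zero hτ hα hM hατ
    ENNReal.ofReal_lt_top)) (tendsto_integral_sparsityWeight hτ hu hK)
  simpa using tendsto_integral_sparsityWeight (M := M) (α := α) hτ (u := fun _ => 1)
    measurable_const (K := 1) (by simp)

/-- The aggregate is a ratio of prior integrals of bounded functions, each of which converges under
truncation by dominated convergence; the limiting denominator is positive. -/
lemma tendsto_ewa_sparsityPrior (hτ : 0 < τ) (hα : 0 < α) (hM : 0 < M)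
    (hατ : α ≤ 1 / (4 * M * τ)) {𝒵 : Type*} {n : ℕ} {Z : Fin n → 𝒵} {F : (Fin M → ℝ) → 𝒵 → ℝ}
    (hF : ∀ i, Measurable fun lam => F lam (Z i)) {β : ℝ} (hβ : 0 < β) (y : Fin n → ℝ)
    (i : Fin n) :
    Tendsto (fun k : ℕ => ewa Z F (sparsityPrior M α τ k) β y (Z i)) atTop
      (𝓝 (ewa Z F (sparsityPrior M α τ ∞) β y (Z i))) := by
  have hp := isProbabilityMeasure_sparsityPrior hτ hα hM hατ (R := ∞) ENNReal.ofReal_lt_top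
  have hE : ∀ lam, |Real.exp (-(β⁻¹ * ∑ i, (y i - F lam (Z i)) ^ 2))| ≤ 1 := fun lam => by
    rw [abs_of_pos (Real.exp_pos _)]
    exact exp_neg_sq_loss_le_one hβ y fun i => F lam (Z i)
  simp only [ewa_eq_div]
  refine Tendsto.div ?_ ?_ ?_
  · exact tendsto_integral_sparsityPrior hτ hα hM hατ (by fun_prop)
      fun lam => abs_exp_neg_sq_loss_mul_le hβ y (fun i => F lam (Z i)) i
  · exact tendsto_integral_sparsityPrior hτ hα hM hατ (by fun_prop) hE
  · exact (integral_exp_pos (integrable_of_abs_le (by fun_prop) hE)).ne'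

end Truncation

/-! ### Monotonicity in the radius, and removal of the truncation. -/

lemma l1Ball_mono {M : ℕ} {R R' : ℝ≥0∞} (h : R ≤ R') : l1Ball M R ⊆ l1Ball M R' :=
  fun lam hlam => le_trans (show ENNReal.ofReal (l1Norm lam) ≤ R from hlam) h

lemma spread_mono {𝒵 Λ : Type*} {n : ℕ} (Z : Fin n → 𝒵) (F : Λ → 𝒵 → ℝ) {S S' : Set Λ}
    (h : S ⊆ S') : spread Z F S ≤ spread Z F S' :=
  (biSup_mono fun _ hlam => h hlam).trans
    (iSup₂_mono fun _ _ => biSup_mono fun _ hlam' => h hlam')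

lemma supOn_mono {s s' : Set ℝ} (h : s ⊆ s') (u : ℝ → ℝ) : supOn s u ≤ supOn s' u :=
  biSup_mono fun _ hx => h hx

lemma linkConst_mono {𝒵 : Type*} {n M : ℕ} (Z : Fin n → 𝒵) (φ : Fin M → 𝒵 → ℝ) {R R' : ℝ≥0∞}
    (h : R ≤ R') (g : ℝ → ℝ) (f : 𝒵 → ℝ) : linkConst Z φ R g f ≤ linkConst Z φ R' g f := by
  have hI : linkInterval Z φ R ⊆ linkInterval Z φ R' := fun x hx =>
    le_trans (show ENNReal.ofReal |x| ≤ R * dictSup Z φ from hx) (mul_le_mul' h le_rfl)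
  unfold linkConst
  split_ifs
  · exact le_rfl
  · have h1 := supOn_mono hI
    exact add_le_add (pow_le_pow_left₀ zero_le (h1 _) 2)
      (mul_le_mul' (h1 _) (add_le_add (h1 _) le_rfl))

end SparseEWA

end

theorem theorem2
    {𝒵 : Type*} {n M : ℕ} (hn : 0 < n) (hM : 0 < M)
    (Z : Fin n → 𝒵) (φ : Fin M → 𝒵 → ℝ) (f : 𝒵 → ℝ)
    -- all diagonal entries of the empirical Gram matrix are equal to one
    (hφ : ∀ j, (1 / (n : ℝ)) * ∑ i, φ j (Z i) ^ 2 = 1)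
    (g : ℝ → ℝ) (hg : ContDiff ℝ 2 g)
    -- i.i.d. centred noise with law `ν`
    {Ω : Type*} [MeasurableSpace Ω] (P : Measure Ω) [IsProbabilityMeasure P]
    (ν : Measure ℝ) [IsProbabilityMeasure ν] (ξ : Fin n → Ω → ℝ)
    (hξ_law : ∀ i, HasLaw (ξ i) ν P) (hξ_indep : iIndepFun ξ P)
    (hν_int : Integrable (fun x : ℝ => x) ν) (hν_mean : ∫ x, x ∂ν = 0)
    (t₀ : ℝ≥0∞) (v : ℝ → ℝ≥0) (hN : SparseEWA.AssumptionN ν t₀ v)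
    -- the regression model
    (Y : Fin n → Ω → ℝ) (hY : ∀ i ω, Y i ω = f (Z i) + ξ i ω)
    -- parameters; `∞ / ∞ = 0` in `ℝ≥0∞`
    (R : ℝ≥0∞) (α τ β : ℝ) (hα : 0 < α) (hτ : 0 < τ) (hβ : 0 < β)
    (hβ_ge : max (4 * SparseEWA.supNorm v)
        (2 * SparseEWA.spread Z (SparseEWA.linkFamily g φ) (SparseEWA.l1Ball M R) / t₀) ≤
      ENNReal.ofReal β)
    (hR : ENNReal.ofReal (2 * M * τ) < R) (hατ : α ≤ 1 / (4 * M * τ))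
    (lamStar : Fin M → ℝ)
    (hlamStar : ENNReal.ofReal (SparseEWA.l1Norm lamStar) ≤ R - ENNReal.ofReal (2 * M * τ)) :
    -- the aggregate is well defined at the design points, and its loss is a random variable
    (∀ ω i, Integrable (fun lam => SparseEWA.linkFamily g φ lam (Z i))
      (SparseEWA.posterior Z (SparseEWA.linkFamily g φ) (SparseEWA.sparsityPrior M α τ R) β
        (fun i => Y i ω))) ∧
    AEMeasurable (fun ω => SparseEWA.empNormSq Z (fun z =>
      SparseEWA.ewa Z (SparseEWA.linkFamily g φ) (SparseEWA.sparsityPrior M α τ R) β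
        (fun i => Y i ω) z - f z)) P ∧
    ∫⁻ ω, ENNReal.ofReal (SparseEWA.empNormSq Z (fun z =>
        SparseEWA.ewa Z (SparseEWA.linkFamily g φ) (SparseEWA.sparsityPrior M α τ R) β
          (fun i => Y i ω) z - f z)) ∂P ≤
      ENNReal.ofReal
        (SparseEWA.empNormSq Z (fun z => SparseEWA.linkFamily g φ lamStar z - f z)
          + 4 * β / n * ∑ j, Real.log (1 + |lamStar j| / τ)
          + 2 * β * (α * SparseEWA.l1Norm lamStar + 1) / n)
      + ENNReal.ofReal (4 * Real.exp 1 * τ ^ 2 * M) * SparseEWA.linkConst Z φ R g f := by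
  have hF : ∀ i, Measurable fun lam => SparseEWA.linkFamily g φ lam (Z i) := fun i =>
    (SparseEWA.continuous_linkFamily hg.continuous φ (Z i)).measurable
  have hYm : AEMeasurable (fun ω i => Y i ω) P := by
    refine aemeasurable_pi_iff.2 fun i => ?_
    simp only [hY]
    exact (hξ_law i).aemeasurable.const_add _
  have hmeas : ∀ R' : ℝ≥0∞, ENNReal.ofReal (2 * M * τ) < R' →
      AEMeasurable (fun ω => SparseEWA.empNormSq Z (fun z =>
        SparseEWA.ewa Z (SparseEWA.linkFamily g φ) (SparseEWA.sparsityPrior M α τ R') β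
          (fun i => Y i ω) z - f z)) P := fun R' hR' => by
    have hp := SparseEWA.isProbabilityMeasure_sparsityPrior hτ hα hM hατ hR'
    unfold SparseEWA.empNormSq
    have h1 : Measurable fun y : Fin n → ℝ => (1 / (n : ℝ)) * ∑ i,
        (SparseEWA.ewa Z (SparseEWA.linkFamily g φ) (SparseEWA.sparsityPrior M α τ R') β y (Z i) -
          f (Z i)) ^ 2 := by
      have := fun i => SparseEWA.measurable_ewa (π := SparseEWA.sparsityPrior M α τ R')
        (β := β) hF i
      fun_prop
    exact h1.comp_aemeasurable hYm
  refine ⟨fun ω i => ?_, hmeas R hR, ?_⟩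
  · have hp := SparseEWA.isProbabilityMeasure_sparsityPrior hτ hα hM hατ hR
    exact SparseEWA.integrable_posterior hF hβ _ i
  rcases ne_or_eq R ∞ with hRtop | rfl
  · exact SparseEWA.lintegral_empNormSq_ewa_le_of_ne_top hn hM Z φ f hφ hg hξ_law hξ_indep hν_int
      hν_mean hN hY hRtop hα hτ hβ hβ_ge hR hατ lamStar hlamStar
  -- for `R = ∞`, truncate the prior and apply Fatou's lemma
  set b := ENNReal.ofReal
        (SparseEWA.empNormSq Z (fun z => SparseEWA.linkFamily g φ lamStar z - f z)
          + 4 * β / n * ∑ j, Real.log (1 + |lamStar j| / τ)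
          + 2 * β * (α * SparseEWA.l1Norm lamStar + 1) / n)
      + ENNReal.ofReal (4 * Real.exp 1 * τ ^ 2 * M) * SparseEWA.linkConst Z φ ∞ g f with hb
  -- From this radius on, `lamStar` is an admissible centre for the truncated prior.
  obtain ⟨k₀, hk₀⟩ := exists_nat_gt (SparseEWA.l1Norm lamStar + 2 * M * τ)
  have hMτ : 0 ≤ 2 * M * τ := by positivity
  have hlS := SparseEWA.l1Norm_nonneg lamStar
  have hkR : ∀ k : ℕ, ENNReal.ofReal (2 * M * τ) < ((k + k₀ : ℕ) : ℝ≥0∞) := fun k => by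
    rw [← ENNReal.ofReal_natCast, ENNReal.ofReal_lt_ofReal_iff_of_nonneg hMτ]
    push_cast
    have : (0 : ℝ) ≤ k := Nat.cast_nonneg k
    linarith
  have hbound : ∀ k : ℕ, ∫⁻ ω, ENNReal.ofReal (SparseEWA.empNormSq Z (fun z =>
        SparseEWA.ewa Z (SparseEWA.linkFamily g φ)
          (SparseEWA.sparsityPrior M α τ ((k + k₀ : ℕ) : ℝ≥0∞)) β
          (fun i => Y i ω) z - f z)) ∂P ≤ b := fun k => by
    refine (SparseEWA.lintegral_empNormSq_ewa_le_of_ne_top hn hM Z φ f hφ hg hξ_law hξ_indep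
      hν_int hν_mean hN hY (ENNReal.natCast_ne_top _) hα hτ hβ (le_trans ?_ hβ_ge) (hkR k) hατ
      lamStar ?_).trans ?_
    -- The spread over a ball is at most that over the whole space, so the condition on `β` is
    -- inherited; if the latter spread is infinite then `t₀ = ∞`, since `β` is finite.
    · refine max_le_max le_rfl ?_
      exact ENNReal.div_le_div_right (mul_le_mul' le_rfl
        (SparseEWA.spread_mono Z _ (SparseEWA.l1Ball_mono le_top))) _
    · refine ENNReal.le_sub_of_add_le_right ENNReal.ofReal_ne_top ?_
      rw [← ENNReal.ofReal_add hlS hMτ, ← ENNReal.ofReal_natCast]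
      refine ENNReal.ofReal_le_ofReal ?_
      push_cast
      have : (0 : ℝ) ≤ k := Nat.cast_nonneg k
      linarith
    · exact add_le_add le_rfl (mul_le_mul' le_rfl (SparseEWA.linkConst_mono Z φ le_top g f))
  have hlim : ∀ ω, Tendsto (fun k : ℕ => ENNReal.ofReal (SparseEWA.empNormSq Z (fun z =>
        SparseEWA.ewa Z (SparseEWA.linkFamily g φ)
          (SparseEWA.sparsityPrior M α τ ((k + k₀ : ℕ) : ℝ≥0∞)) β
          (fun i => Y i ω) z - f z))) atTop (𝓝 (ENNReal.ofReal (SparseEWA.empNormSq Z (fun z =>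
        SparseEWA.ewa Z (SparseEWA.linkFamily g φ) (SparseEWA.sparsityPrior M α τ ∞) β
          (fun i => Y i ω) z - f z)))) := fun ω => by
    refine ENNReal.tendsto_ofReal ?_
    unfold SparseEWA.empNormSq
    refine Tendsto.const_mul _ (tendsto_finsetSum _ fun i _ => ?_)
    refine Tendsto.pow (Tendsto.sub_const ?_ _) 2
    exact (SparseEWA.tendsto_ewa_sparsityPrior hτ hα hM hατ hF hβ (fun i => Y i ω) i).comp
      (tendsto_add_atTop_nat k₀)
  calc _ = ∫⁻ ω, liminf (fun k : ℕ => ENNReal.ofReal (SparseEWA.empNormSq Z (fun z =>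
        SparseEWA.ewa Z (SparseEWA.linkFamily g φ)
          (SparseEWA.sparsityPrior M α τ ((k + k₀ : ℕ) : ℝ≥0∞)) β
          (fun i => Y i ω) z - f z))) atTop ∂P :=
        lintegral_congr fun ω => (hlim ω).liminf_eq.symm
    _ ≤ _ := lintegral_liminf_le' fun k => (hmeas _ (hkR k)).ennreal_ofReal
    _ ≤ liminf (fun _ : ℕ => b) atTop := liminf_le_liminf (Eventually.of_forall hbound)
    _ = b := liminf_const b
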